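/- Work over $\mathbb{Q}$. Let $X$ be a simply connected space of the homotopy type of a CW complex of finite type (finitely many cells in each dimension), and let $(\Lambda V,d)$ be a Sullivan model of $X$: a Sullivan algebra ($V=V^{\ge 1}$ is the union of graded subspaces $V(0)\subset V(1)\subset\cdots$ with $d=0$ on $V(0)$ and $dV(k+1)\subset\Lambda V(k)$) together with a quasi-isomorphism of commutative cochain algebras $(\Lambda V,d)\to A_{PL}(X)$, where $A_{PL}(X)$ is Sullivan's cochain algebra of polynomial differential forms on the singular simplices of $X$. Let $\mu\colon(\Lambda V\otimes\Lambda V,d)\to(\Lambda V,d)$ be the multiplication and, for $n\ge 0$, let $$p_n\colon(\Lambda V\otimes\Lambda V,d)\to\left(\frac{\Lambda V\otimes\Lambda V}{(\ker\mu)^{n+1}},\bar d\right)$$ be the projection. A morphism $f\colon M\to N$ of differential ($\mathbb{Z}$-graded) modules over a commutative cochain algebra admits a homotopy retraction if there are a differential module $P$, a quasi-isomorphism of modules $\psi\colon P\to N$ and morphisms of modules $j\colon M\to P$, $\rho\colon P\to M$ with $\psi j=f$ and $\rho j=\mathrm{id}_M$. Let $\mathbf{mtc}(X)$ be the least integer $n\ge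 0$ such that $p_n$ admits a homotopy retraction as a morphism of $(\Lambda V\otimes\Lambda V,d)$-modules, and $\mathbf{htc}(X)$ the least integer $n\ge 0$ such that $H(p_n)$ is injective (each is $\infty$ if there is no such $n$). A Poincaré duality algebra is a finite dimensional commutative graded algebra $H$ with $H^0=\mathbb{Q}$, concentrated in degrees $0\le p\le n$ for some $n$, for which there is $\Omega\in H^n$ with $H^n=\mathbb{Q}\cdot\Omega$ such that $a\mapsto(b\mapsto\Omega^\sharp(ab))$ is an isomorphism $H\to\operatorname{Hom}(H,\mathbb{Q})$, where $\Omega^\sharp(\Omega)=1$ and $\Omega^\sharp(H^{\ne n})=0$. If the rational cohomology algebra $H^*(X)=H(A_{PL}(X))$ is a Poincaré duality algebra, then $\mathbf{htc}(X)=\mathbf{mtc}(X)$. -/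

import Mathlib

universe u v w

noncomputable section

open scoped DirectSum TensorProduct

namespace RHT

/-! ### Gradings -/

/-- A family of subspaces that spans and admits a family of projections is a grading. -/
theorem isInternal_of_proj {M : Type u} [AddCommGroup M] [Module ℚ M] (G : ℤ → Submodule ℚ M)
    (π : ℤ → M →ₗ[ℚ] M) (h1 : ∀ p, ∀ x ∈ G p, π p x = x)
    (h2 : ∀ p q, q ≠ p → ∀ x ∈ G q, π p x = 0) (h3 : ⨆ p, G p = ⊤) :
    DirectSum.IsInternal G := by
  refine DirectSum.isInternal_submodule_of_iSupIndep_of_iSup_eq_top (fun p => ?_) h3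
  rw [Submodule.disjoint_def]
  intro x hx hx'
  have hk : (⨆ q, ⨆ (_ : q ≠ p), G q) ≤ LinearMap.ker (π p) :=
    iSup₂_le fun q hq y hy => h2 p q hq y hy
  rw [← h1 p x hx]
  exact hk hx'

/-- The projection onto the component of degree `p` of a graded vector space. -/
def proj {M : Type u} [AddCommGroup M] [Module ℚ M] {G : ℤ → Submodule ℚ M}
    (hG : DirectSum.IsInternal G) (p : ℤ) : M →ₗ[ℚ] M :=
  letI := hG.chooseDecomposition
  (G p).subtype ∘ₗ DirectSum.component ℚ ℤ (fun i => G i) p ∘ₗ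
    (DirectSum.decomposeLinearEquiv G).toLinearMap

theorem proj_of_mem {M : Type u} [AddCommGroup M] [Module ℚ M] {G : ℤ → Submodule ℚ M}
    (hG : DirectSum.IsInternal G) {p : ℤ} {x : M} (hx : x ∈ G p) : proj hG p x = x :=
  letI := hG.chooseDecomposition
  DirectSum.decompose_of_mem_same G hx

theorem proj_of_mem_ne {M : Type u} [AddCommGroup M] [Module ℚ M] {G : ℤ → Submodule ℚ M}
    (hG : DirectSum.IsInternal G) {p q : ℤ} (h : q ≠ p) {x : M} (hx : x ∈ G q) :
    proj hG p x = 0 :=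
  letI := hG.chooseDecomposition
  DirectSum.decompose_of_mem_ne G hx h

theorem exists_sum_proj {M : Type u} [AddCommGroup M] [Module ℚ M] {G : ℤ → Submodule ℚ M}
    (hG : DirectSum.IsInternal G) (x : M) : ∃ s : Finset ℤ, ∑ p ∈ s, proj hG p x = x := by
  classical
  let := hG.chooseDecomposition
  exact ⟨_, DirectSum.sum_support_decompose G x⟩

/-- Two linear maps that agree on homogeneous elements are equal. -/
theorem homogeneous_induction {M : Type u} [AddCommGroup M] [Module ℚ M]
    {G : ℤ → Submodule ℚ M} (hG : DirectSum.IsInternal G) {N : Type v} [AddCommGroup N]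
    [Module ℚ N] {f g : M →ₗ[ℚ] N} (h : ∀ p, ∀ x ∈ G p, f x = g x) (x : M) : f x = g x := by
  have : (⊤ : Submodule ℚ M) ≤ LinearMap.eqLocus f g := by
    rw [← hG.submodule_iSup_eq_top]
    exact iSup_le fun p x hx => h p x hx
  exact this (Submodule.mem_top : x ∈ ⊤)

theorem proj_mem {M : Type u} [AddCommGroup M] [Module ℚ M] {G : ℤ → Submodule ℚ M}
    (hG : DirectSum.IsInternal G) (p : ℤ) (x : M) : proj hG p x ∈ G p :=
  Subtype.prop _

/-! ### Cohomology of a differential vector space -/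

/-- The cohomology `ker d / im d` of a differential vector space `(M, d)`. -/
def Cohomology {M : Type u} [AddCommGroup M] [Module ℚ M] (d : M →ₗ[ℚ] M) : Type u :=
  LinearMap.ker d ⧸ (LinearMap.range d).submoduleOf (LinearMap.ker d)

namespace Cohomology

variable {M : Type u} [AddCommGroup M] [Module ℚ M] {N : Type v} [AddCommGroup N] [Module ℚ N]

instance (d : M →ₗ[ℚ] M) : AddCommGroup (Cohomology d) :=
  inferInstanceAs (AddCommGroup (LinearMap.ker d ⧸ (LinearMap.range d).submoduleOf _))

instance (d : M →ₗ[ℚ] M) : Module ℚ (Cohomology d) :=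
  inferInstanceAs (Module ℚ (LinearMap.ker d ⧸ (LinearMap.range d).submoduleOf _))

/-- The class of a cocycle. -/
def cls (d : M →ₗ[ℚ] M) : LinearMap.ker d →ₗ[ℚ] Cohomology d :=
  Submodule.mkQ _

theorem cls_surjective (d : M →ₗ[ℚ] M) : Function.Surjective (cls d) :=
  Submodule.mkQ_surjective _

theorem cls_eq_zero {d : M →ₗ[ℚ] M} (z : LinearMap.ker d) :
    cls d z = 0 ↔ ∃ x, d x = z := by
  exact Submodule.Quotient.mk_eq_zero _

/-- The map induced in cohomology by a linear map that commutes with the differentials. -/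
def map {d : M →ₗ[ℚ] M} {d' : N →ₗ[ℚ] N} (f : M →ₗ[ℚ] N) (hf : ∀ x, f (d x) = d' (f x)) :
    Cohomology d →ₗ[ℚ] Cohomology d' :=
  Submodule.mapQ _ _
    (f.restrict (p := LinearMap.ker d) (q := LinearMap.ker d') fun x hx => by
      rw [LinearMap.mem_ker] at hx ⊢; rw [← hf, hx, map_zero])
    (by
      rintro ⟨x, hx⟩ ⟨y, hy⟩
      exact ⟨f y, by rw [← hf, hy]; rfl⟩)

theorem map_cls {d : M →ₗ[ℚ] M} {d' : N →ₗ[ℚ] N} (f : M →ₗ[ℚ] N)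
    (hf : ∀ x, f (d x) = d' (f x)) (z : LinearMap.ker d) (hz : f z ∈ LinearMap.ker d') :
    map f hf (cls d z) = cls d' ⟨f z, hz⟩ := rfl

end Cohomology

/-! ### Commutative graded algebras and commutative cochain algebras -/

/-- A commutative graded algebra over `ℚ`. -/
structure CGA where
  carrier : Type u
  [ring : Ring carrier]
  [algebra : Algebra ℚ carrier]
  gr : ℤ → Submodule ℚ carrier
  [graded : GradedAlgebra gr]
  comm : ∀ {p q : ℤ} {a b : carrier}, a ∈ gr p → b ∈ gr q →
    a * b = ((-1 : ℚ) ^ (p * q)) • (b * a)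

attribute [instance] CGA.ring CGA.algebra CGA.graded

/-- A commutative cochain algebra over `ℚ`: a commutative graded algebra concentrated in
non-negative degrees, with a differential of degree `1` that is a derivation. -/
structure CDGA extends CGA.{u} where
  gr_neg : ∀ p : ℤ, p < 0 → gr p = ⊥
  d : carrier →ₗ[ℚ] carrier
  d_mem : ∀ {p : ℤ} {a : carrier}, a ∈ gr p → d a ∈ gr (p + 1)
  d_d : ∀ a, d (d a) = 0
  leibniz : ∀ {p : ℤ} {a : carrier}, a ∈ gr p → ∀ b : carrier,
    d (a * b) = d a * b + ((-1 : ℚ) ^ p) • (a * d b)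

instance : CoeSort CGA.{u} (Type u) := ⟨CGA.carrier⟩
instance : CoeSort CDGA.{u} (Type u) := ⟨fun A => A.carrier⟩

/-- A Poincaré duality algebra: a finite dimensional commutative graded algebra `H` with `H⁰ = ℚ`,
concentrated in degrees `0 ≤ p ≤ n`, with a class `Ω` spanning `Hⁿ` such that the map
`a ↦ (b ↦ Ω♯(a b))` from `H` to `Hom(H, ℚ)` is an isomorphism. -/
def CGA.IsPoincareDualityAlgebra (H : CGA.{u}) : Prop :=
  FiniteDimensional ℚ H ∧ Nontrivial H ∧ H.gr 0 = Submodule.span ℚ {1} ∧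
  ∃ n : ℕ, (∀ p : ℤ, p < 0 ∨ (n : ℤ) < p → H.gr p = ⊥) ∧
    ∃ Ω ∈ H.gr n, H.gr n = Submodule.span ℚ {Ω} ∧
      ∃ Ωsharp : H →ₗ[ℚ] ℚ, Ωsharp Ω = 1 ∧ (∀ p : ℤ, p ≠ n → ∀ x ∈ H.gr p, Ωsharp x = 0) ∧
        Function.Bijective fun a : H => Ωsharp ∘ₗ LinearMap.mulLeft ℚ a

namespace CDGA

variable (A : CDGA.{u})

theorem internal : DirectSum.IsInternal A.gr := DirectSum.Decomposition.isInternal A.gr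

/-- The degree involution `a ↦ (-1)^|a| a`. -/
def eps : A →ₗ[ℚ] A :=
  DirectSum.toModule ℚ ℤ A (fun p => ((-1 : ℚ) ^ p) • (A.gr p).subtype) ∘ₗ
    (DirectSum.decomposeLinearEquiv A.gr).toLinearMap

theorem eps_of_mem {p : ℤ} {a : A} (ha : a ∈ A.gr p) : A.eps a = ((-1 : ℚ) ^ p) • a := by
  have h : DirectSum.decomposeLinearEquiv A.gr a =
      DirectSum.lof ℚ ℤ (fun i => A.gr i) p ⟨a, ha⟩ := DirectSum.decompose_of_mem _ ha
  simp [eps, h]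

theorem d_mul (a b : A) : A.d (a * b) = A.d a * b + A.eps a * A.d b := by
  refine homogeneous_induction A.internal
    (f := A.d ∘ₗ (LinearMap.mul ℚ A).flip b)
    (g := (LinearMap.mul ℚ A).flip b ∘ₗ A.d + (LinearMap.mul ℚ A).flip (A.d b) ∘ₗ A.eps) ?_ a
  intro p x hx
  simp [A.leibniz hx, A.eps_of_mem hx]

theorem eps_eps (a : A) : A.eps (A.eps a) = a := by
  refine homogeneous_induction A.internal (f := A.eps ∘ₗ A.eps) (g := LinearMap.id) ?_ a
  intro p x hx
  simp only [LinearMap.comp_apply, A.eps_of_mem hx, map_smul, smul_smul, LinearMap.id_apply,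
    ← mul_zpow]
  simp

theorem d_eps (a : A) : A.d (A.eps a) = - A.eps (A.d a) := by
  refine homogeneous_induction A.internal (f := A.d ∘ₗ A.eps) (g := - (A.eps ∘ₗ A.d)) ?_ a
  intro p x hx
  simp [A.eps_of_mem hx, A.eps_of_mem (A.d_mem hx), zpow_add₀]

theorem eps_mul (a b : A) : A.eps (a * b) = A.eps a * A.eps b := by
  refine homogeneous_induction A.internal (f := A.eps ∘ₗ (LinearMap.mul ℚ A).flip b)
    (g := (LinearMap.mul ℚ A).flip (A.eps b) ∘ₗ A.eps) ?_ a
  intro p x hx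
  refine homogeneous_induction A.internal (f := A.eps ∘ₗ LinearMap.mul ℚ A x)
    (g := LinearMap.mul ℚ A (A.eps x) ∘ₗ A.eps) ?_ b
  intro q y hy
  simp [A.eps_of_mem hx, A.eps_of_mem hy, A.eps_of_mem (SetLike.GradedMul.mul_mem hx hy),
    zpow_add₀, smul_smul]

theorem d_one : A.d 1 = 0 := by
  have h := A.leibniz (SetLike.GradedOne.one_mem : (1 : A) ∈ A.gr 0) 1
  simpa using h

theorem proj_d (p : ℤ) (a : A) : proj A.internal (p + 1) (A.d a) = A.d (proj A.internal p a) := by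
  refine homogeneous_induction A.internal (f := proj A.internal (p + 1) ∘ₗ A.d)
    (g := A.d ∘ₗ proj A.internal p) ?_ a
  intro q x hx
  by_cases h : q = p
  · subst h
    simp [proj_of_mem _ hx, proj_of_mem _ (A.d_mem hx)]
  · simp [proj_of_mem_ne _ h hx, proj_of_mem_ne _ (show q + 1 ≠ p + 1 by omega) (A.d_mem hx)]

/-! ### The cohomology algebra -/

/-- The underlying vector space of the cohomology algebra `H(A, d)`. -/
abbrev H : Type u := Cohomology A.d

theorem mul_mem_ker {a b : A} (ha : A.d a = 0) (hb : A.d b = 0) : A.d (a * b) = 0 := by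
  rw [d_mul, ha, hb, zero_mul, mul_zero, add_zero]

/-- The product of cocycles. -/
def mulZ : LinearMap.ker A.d →ₗ[ℚ] LinearMap.ker A.d →ₗ[ℚ] LinearMap.ker A.d :=
  LinearMap.mk₂ ℚ (fun a b => ⟨a.1 * b.1, A.mul_mem_ker a.2 b.2⟩)
    (fun _ _ _ => Subtype.ext (add_mul _ _ _)) (fun _ _ _ => Subtype.ext (smul_mul_assoc _ _ _))
    (fun _ _ _ => Subtype.ext (mul_add _ _ _)) (fun _ _ _ => Subtype.ext (mul_smul_comm _ _ _))

theorem cls_mulZ_left {a b : LinearMap.ker A.d} (h : Cohomology.cls A.d a = 0) :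
    Cohomology.cls A.d (A.mulZ a b) = 0 := by
  obtain ⟨x, hx⟩ := (Cohomology.cls_eq_zero a).1 h
  refine (Cohomology.cls_eq_zero _).2 ⟨x * b, ?_⟩
  rw [d_mul, hx, show A.d (b : A) = 0 from b.2, mul_zero, add_zero]
  rfl

theorem cls_mulZ_right {a b : LinearMap.ker A.d} (h : Cohomology.cls A.d b = 0) :
    Cohomology.cls A.d (A.mulZ a b) = 0 := by
  obtain ⟨x, hx⟩ := (Cohomology.cls_eq_zero b).1 h
  refine (Cohomology.cls_eq_zero _).2 ⟨A.eps a * x, ?_⟩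
  rw [d_mul, hx, d_eps, show A.d (a : A) = 0 from a.2, map_zero, neg_zero, zero_mul, zero_add,
    eps_eps]
  rfl

/-- The product `[a] [b] = [a b]` of cohomology classes. -/
def mulH : A.H →ₗ[ℚ] A.H →ₗ[ℚ] A.H :=
  Submodule.liftQ _
    { toFun := fun a => Submodule.liftQ _ (Cohomology.cls A.d ∘ₗ A.mulZ a) (fun b hb =>
        A.cls_mulZ_right ((Submodule.Quotient.mk_eq_zero _).2 hb))
      map_add' := fun a b => by
        apply LinearMap.ext; intro c
        obtain ⟨c, rfl⟩ := Cohomology.cls_surjective _ c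
        change Cohomology.cls A.d (A.mulZ (a + b) c) =
          Cohomology.cls A.d (A.mulZ a c) + Cohomology.cls A.d (A.mulZ b c)
        rw [map_add, LinearMap.add_apply, map_add]
      map_smul' := fun r a => by
        apply LinearMap.ext; intro c
        obtain ⟨c, rfl⟩ := Cohomology.cls_surjective _ c
        change Cohomology.cls A.d (A.mulZ (r • a) c) = r • Cohomology.cls A.d (A.mulZ a c)
        rw [map_smul, LinearMap.smul_apply, map_smul] }
    (fun a ha => by
      apply LinearMap.ext; intro c
      obtain ⟨c, rfl⟩ := Cohomology.cls_surjective _ c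
      exact A.cls_mulZ_left ((Submodule.Quotient.mk_eq_zero _).2 ha))

theorem mulH_cls (a b : LinearMap.ker A.d) :
    A.mulH (Cohomology.cls A.d a) (Cohomology.cls A.d b) = Cohomology.cls A.d (A.mulZ a b) := rfl

instance : Ring A.H :=
  { (inferInstance : AddCommGroup A.H) with
    mul := fun a b => A.mulH a b
    one := Cohomology.cls A.d ⟨1, A.d_one⟩
    left_distrib := fun a b c => map_add (A.mulH a) b c
    right_distrib := fun a b c => LinearMap.map_add₂ A.mulH a b c
    zero_mul := fun a => LinearMap.map_zero₂ A.mulH a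
    mul_zero := fun a => map_zero (A.mulH a)
    mul_assoc := fun a b c => by
      obtain ⟨a, rfl⟩ := Cohomology.cls_surjective _ a
      obtain ⟨b, rfl⟩ := Cohomology.cls_surjective _ b
      obtain ⟨c, rfl⟩ := Cohomology.cls_surjective _ c
      exact congrArg (Cohomology.cls A.d) (Subtype.ext (mul_assoc _ _ _))
    one_mul := fun a => by
      obtain ⟨a, rfl⟩ := Cohomology.cls_surjective _ a
      exact congrArg (Cohomology.cls A.d) (Subtype.ext (one_mul _))
    mul_one := fun a => by
      obtain ⟨a, rfl⟩ := Cohomology.cls_surjective _ a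
      exact congrArg (Cohomology.cls A.d) (Subtype.ext (mul_one _)) }

theorem cls_mul (a b : LinearMap.ker A.d) :
    Cohomology.cls A.d a * Cohomology.cls A.d b = Cohomology.cls A.d (A.mulZ a b) := rfl

instance : Algebra ℚ A.H :=
  Algebra.ofModule (fun r a b => LinearMap.map_smul₂ A.mulH r a b)
    (fun r a b => map_smul (A.mulH a) r b)

/-- `Hᵖ(A, d)`: the classes of the cocycles of degree `p`. -/
def grH (p : ℤ) : Submodule ℚ A.H :=
  ((A.gr p).comap (LinearMap.ker A.d).subtype).map (Cohomology.cls A.d)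

theorem internalH : DirectSum.IsInternal A.grH := by
  have hz : ∀ p, ∀ z ∈ LinearMap.ker A.d, proj A.internal p z ∈ LinearMap.ker A.d := by
    intro p z hz
    rw [LinearMap.mem_ker] at hz ⊢
    rw [← proj_d, hz, map_zero]
  refine isInternal_of_proj A.grH
    (fun p => Submodule.mapQ _ _ ((proj A.internal p).restrict (hz p)) ?_) ?_ ?_ ?_
  · rintro ⟨x, hx⟩ ⟨y, hy⟩
    refine ⟨proj A.internal (p - 1) y, ?_⟩
    rw [← proj_d, sub_add_cancel, hy]; rfl
  · rintro p _ ⟨z, hz, rfl⟩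
    exact congrArg (Cohomology.cls A.d) (Subtype.ext (proj_of_mem A.internal hz))
  · rintro p q hpq _ ⟨z, hz, rfl⟩
    refine (congrArg (Cohomology.cls A.d) (Subtype.ext
      (proj_of_mem_ne A.internal hpq hz) : _ = (0 : LinearMap.ker A.d))).trans (map_zero _)
  · rw [eq_top_iff]
    rintro x -
    obtain ⟨z, rfl⟩ := Cohomology.cls_surjective _ x
    obtain ⟨s, hs⟩ := exists_sum_proj A.internal (z : A)
    have h : z = ∑ p ∈ s, (⟨proj A.internal p z, hz p _ z.2⟩ : LinearMap.ker A.d) := by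
      apply Subtype.ext
      rw [AddSubmonoidClass.coe_finsetSum]
      exact hs.symm
    rw [h, map_sum]
    refine Submodule.sum_mem _ fun p _ => ?_
    exact Submodule.mem_iSup_of_mem p ⟨_, proj_mem A.internal p _, rfl⟩

instance : GradedAlgebra A.grH where
  one_mem := ⟨⟨1, A.d_one⟩, (SetLike.GradedOne.one_mem : (1 : A) ∈ A.gr 0), rfl⟩
  mul_mem := by
    rintro p q _ _ ⟨a, ha, rfl⟩ ⟨b, hb, rfl⟩
    exact ⟨A.mulZ a b, (SetLike.GradedMul.mul_mem ha hb : (a * b : A) ∈ A.gr (p + q)), rfl⟩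
  toDecomposition := A.internalH.chooseDecomposition

/-- The cohomology algebra `H(A, d)` of a commutative cochain algebra. -/
def cohomology : CGA.{u} where
  carrier := A.H
  gr := A.grH
  comm := by
    rintro p q _ _ ⟨a, ha, rfl⟩ ⟨b, hb, rfl⟩
    rw [cls_mul, cls_mul, ← map_smul]
    exact congrArg (Cohomology.cls A.d) (Subtype.ext (A.comm ha hb))

/-- A morphism of commutative cochain algebras. -/
structure Hom (A : CDGA.{u}) (B : CDGA.{v}) where
  toAlgHom : A →ₐ[ℚ] B
  map_gr : ∀ {p : ℤ} {a : A}, a ∈ A.gr p → toAlgHom a ∈ B.gr p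
  map_d : ∀ a, toAlgHom (A.d a) = B.d (toAlgHom a)

/-- `H(f)` is an isomorphism. -/
def Hom.IsQuasiIso {A : CDGA.{u}} {B : CDGA.{v}} (f : Hom A B) : Prop :=
  Function.Bijective (Cohomology.map (d := A.d) (d' := B.d) f.toAlgHom.toLinearMap f.map_d)

end CDGA

/-! ### Differential modules -/

/-- A differential module over `(A, d)`. -/
structure DGModule (A : CDGA.{u}) where
  carrier : Type v
  [addCommGroup : AddCommGroup carrier]
  [moduleRat : Module ℚ carrier]
  [module : Module A carrier]
  [tower : IsScalarTower ℚ A carrier]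
  gr : ℤ → Submodule ℚ carrier
  internal : DirectSum.IsInternal gr
  smul_mem : ∀ {p q : ℤ} {a : A} {m : carrier}, a ∈ A.gr p → m ∈ gr q → a • m ∈ gr (p + q)
  d : carrier →ₗ[ℚ] carrier
  d_mem : ∀ {p : ℤ} {m : carrier}, m ∈ gr p → d m ∈ gr (p + 1)
  d_d : ∀ m, d (d m) = 0
  leibniz : ∀ {p : ℤ} {a : A}, a ∈ A.gr p → ∀ m : carrier,
    d (a • m) = A.d a • m + ((-1 : ℚ) ^ p) • (a • d m)

attribute [instance] DGModule.addCommGroup DGModule.moduleRat DGModule.module DGModule.tower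

instance (A : CDGA.{u}) : CoeSort (DGModule.{u, v} A) (Type v) := ⟨DGModule.carrier⟩

namespace DGModule

variable {A : CDGA.{u}}

/-- A morphism of `(A, d)`-modules (of degree `0`). -/
structure Hom (M : DGModule.{u, v} A) (N : DGModule.{u, w} A) where
  toLinearMap : M →ₗ[A] N
  map_gr : ∀ {p : ℤ} {m : M}, m ∈ M.gr p → toLinearMap m ∈ N.gr p
  map_d : ∀ m, toLinearMap (M.d m) = N.d (toLinearMap m)

/-- The map `H(f)` induced in cohomology by a morphism of `(A, d)`-modules. -/
def Hom.H {M : DGModule.{u, v} A} {N : DGModule.{u, w} A} (f : Hom M N) :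
    Cohomology M.d →ₗ[ℚ] Cohomology N.d :=
  Cohomology.map (f.toLinearMap.restrictScalars ℚ) f.map_d

/-- `H(f)` is an isomorphism. -/
def Hom.IsQuasiIso {M : DGModule.{u, v} A} {N : DGModule.{u, w} A} (f : Hom M N) : Prop :=
  Function.Bijective f.H

/-- `f : M → N` admits a homotopy retraction: there are an `(A, d)`-module `P`, a
quasi-isomorphism `ψ : P → N` and morphisms `j : M → P`, `ρ : P → M` with `ψ j = f` and
`ρ j = id`. -/
def Hom.HasHomotopyRetraction {M N : DGModule.{u, u} A} (f : Hom M N) : Prop :=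
  ∃ (P : DGModule.{u, u} A) (j : Hom M P) (ψ : Hom P N) (ρ : Hom P M), ψ.IsQuasiIso ∧
    (∀ m, ψ.toLinearMap (j.toLinearMap m) = f.toLinearMap m) ∧
    (∀ m, ρ.toLinearMap (j.toLinearMap m) = m)

/-- A differential graded submodule. -/
structure Sub (M : DGModule.{u, v} A) where
  toSubmodule : Submodule A M
  homogeneous : toSubmodule.restrictScalars ℚ ≤ ⨆ p, toSubmodule.restrictScalars ℚ ⊓ M.gr p
  d_mem : ∀ {m : M}, m ∈ toSubmodule → M.d m ∈ toSubmodule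

/-- The quotient of a differential module by a differential graded submodule. -/
def quotient (M : DGModule.{u, v} A) (N : Sub M) : DGModule.{u, v} A where
  carrier := M ⧸ N.toSubmodule
  gr p := (M.gr p).map (N.toSubmodule.mkQ.restrictScalars ℚ)
  internal := by
    have hN : ∀ p, N.toSubmodule.restrictScalars ℚ ≤
        (N.toSubmodule.restrictScalars ℚ).comap (proj M.internal p) := by
      intro p
      refine N.homogeneous.trans (iSup_le fun q => ?_)
      rintro x ⟨hx, hq⟩
      by_cases h : q = p
      · subst h; simpa [proj_of_mem M.internal hq] using hx
      · simp [proj_of_mem_ne M.internal h hq]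
    refine isInternal_of_proj _ (fun p =>
      (Submodule.mapQ (N.toSubmodule.restrictScalars ℚ) (N.toSubmodule.restrictScalars ℚ)
        (proj M.internal p) (hN p) :
          (M ⧸ N.toSubmodule) →ₗ[ℚ] (M ⧸ N.toSubmodule))) ?_ ?_ ?_
    · rintro p _ ⟨x, hx, rfl⟩
      exact congrArg N.toSubmodule.mkQ (proj_of_mem M.internal hx)
    · rintro p q h _ ⟨x, hx, rfl⟩
      exact (congrArg N.toSubmodule.mkQ (proj_of_mem_ne M.internal h hx)).trans (map_zero _)
    · rw [← Submodule.map_iSup, M.internal.submodule_iSup_eq_top, Submodule.map_top,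
        LinearMap.range_eq_top]
      exact N.toSubmodule.mkQ_surjective
  smul_mem := by
    rintro p q a _ ha ⟨m, hm, rfl⟩
    exact ⟨a • m, M.smul_mem ha hm, rfl⟩
  d := (Submodule.mapQ (N.toSubmodule.restrictScalars ℚ) (N.toSubmodule.restrictScalars ℚ) M.d
    (fun _ hm => N.d_mem hm) : (M ⧸ N.toSubmodule) →ₗ[ℚ] (M ⧸ N.toSubmodule))
  d_mem := by
    rintro p _ ⟨m, hm, rfl⟩
    exact ⟨M.d m, M.d_mem hm, rfl⟩
  d_d := by
    intro x
    obtain ⟨m, rfl⟩ := N.toSubmodule.mkQ_surjective x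
    exact (congrArg N.toSubmodule.mkQ (M.d_d m)).trans (map_zero _)
  leibniz := by
    intro p a ha x
    obtain ⟨m, rfl⟩ := N.toSubmodule.mkQ_surjective x
    exact congrArg N.toSubmodule.mkQ (M.leibniz ha m)

/-- The projection onto a quotient module. -/
def quotientMap (M : DGModule.{u, v} A) (N : Sub M) : Hom M (M.quotient N) where
  toLinearMap := N.toSubmodule.mkQ
  map_gr := fun {_ m} hm => ⟨m, hm, rfl⟩
  map_d := fun _ => rfl

end DGModule

namespace CDGA

variable (A : CDGA.{u})

/-- `(A, d)` as a differential module over itself. -/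
def self : DGModule.{u, u} A where
  carrier := A
  gr := A.gr
  internal := A.internal
  smul_mem := fun ha hm => SetLike.GradedMul.mul_mem ha hm
  d := A.d
  d_mem := A.d_mem
  d_d := A.d_d
  leibniz := A.leibniz

/-- A differential graded (left) ideal. -/
structure DGIdeal where
  toIdeal : Ideal A
  homogeneous : toIdeal.restrictScalars ℚ ≤ ⨆ p, toIdeal.restrictScalars ℚ ⊓ A.gr p
  d_mem : ∀ {a : A}, a ∈ toIdeal → A.d a ∈ toIdeal

variable {A}

/-- The kernel of a morphism of commutative cochain algebras. -/
def Hom.ker {B : CDGA.{v}} (f : Hom A B) : A.DGIdeal where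
  toIdeal := RingHom.ker f.toAlgHom
  homogeneous := by
    intro x hx
    have key : ∀ p, f.toAlgHom (proj A.internal p x) = proj B.internal p (f.toAlgHom x) := by
      intro p
      refine homogeneous_induction A.internal (f := f.toAlgHom.toLinearMap ∘ₗ proj A.internal p)
        (g := proj B.internal p ∘ₗ f.toAlgHom.toLinearMap) ?_ x
      intro q y hy
      by_cases h : q = p
      · subst h
        simp [proj_of_mem _ hy, proj_of_mem _ (f.map_gr hy)]
      · simp [proj_of_mem_ne _ h hy, proj_of_mem_ne _ h (f.map_gr hy)]
    obtain ⟨s, hs⟩ := exists_sum_proj A.internal x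
    rw [← hs]
    refine Submodule.sum_mem _ fun p _ => Submodule.mem_iSup_of_mem p ⟨?_, proj_mem A.internal p x⟩
    change f.toAlgHom (proj A.internal p x) = 0
    rw [key, show f.toAlgHom x = 0 from hx, map_zero]
  d_mem := by
    intro x hx
    change f.toAlgHom (A.d x) = 0
    rw [f.map_d, show f.toAlgHom x = 0 from hx, map_zero]

/-- The `n`-th power `Iⁿ` of a differential ideal. -/
def DGIdeal.pow (I : A.DGIdeal) (n : ℕ) : A.DGIdeal where
  toIdeal := I.toIdeal ^ n
  homogeneous := by
    induction n with
    | zero =>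
      intro x _
      have h : x ∈ ⨆ p, A.gr p := by
        rw [A.internal.submodule_iSup_eq_top]; exact Submodule.mem_top
      refine (iSup_mono fun p => ?_ : ⨆ p, A.gr p ≤ _) h
      intro y hy
      refine ⟨?_, hy⟩
      change y ∈ I.toIdeal ^ 0
      rw [Submodule.pow_zero, Ideal.one_eq_top]
      exact Submodule.mem_top
    | succ n ih =>
      intro x hx
      change x ∈ I.toIdeal ^ (n + 1) at hx
      rw [Submodule.pow_succ] at hx
      refine Submodule.mul_induction_on hx ?_ (fun _ _ => Submodule.add_mem _)
      intro a ha b hb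
      refine Submodule.iSup_induction _ (motive := fun a => (a * b : A) ∈ _) (ih ha) ?_ ?_ ?_
      · rintro p a ⟨ha, hap⟩
        refine Submodule.iSup_induction _ (motive := fun b => (a * b : A) ∈ _)
          (I.homogeneous hb) ?_ ?_ ?_
        · rintro q b ⟨hb, hbq⟩
          refine Submodule.mem_iSup_of_mem (p + q) ⟨?_, SetLike.GradedMul.mul_mem hap hbq⟩
          change a * b ∈ I.toIdeal ^ (n + 1)
          rw [Submodule.pow_succ]
          exact Submodule.mul_mem_mul ha hb
        · rw [mul_zero]; exact Submodule.zero_mem _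
        · intro b c hb hc; rw [mul_add]; exact Submodule.add_mem _ hb hc
      · rw [zero_mul]; exact Submodule.zero_mem _
      · intro b c hb hc; rw [add_mul]; exact Submodule.add_mem _ hb hc
  d_mem := by
    have key : (∀ {a : A}, a ∈ I.toIdeal ^ n → A.d a ∈ I.toIdeal ^ n) ∧
        (∀ {a : A}, a ∈ I.toIdeal ^ n → A.eps a ∈ I.toIdeal ^ n) := by
      have heI : ∀ {a : A}, a ∈ I.toIdeal → A.eps a ∈ I.toIdeal := by
        intro a ha
        refine Submodule.iSup_induction _ (motive := fun a => A.eps a ∈ I.toIdeal)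
          (I.homogeneous ha) ?_ ?_ ?_
        · rintro p a ⟨ha, hap⟩
          rw [A.eps_of_mem hap]
          exact (I.toIdeal.restrictScalars ℚ).smul_mem _ ha
        · rw [map_zero]; exact Submodule.zero_mem _
        · intro b c hb hc; rw [map_add]; exact Submodule.add_mem _ hb hc
      induction n with
      | zero =>
        rw [Submodule.pow_zero, Ideal.one_eq_top]
        exact ⟨fun _ => Submodule.mem_top, fun _ => Submodule.mem_top⟩
      | succ n ih =>
        rw [Submodule.pow_succ]
        constructor
        · intro x hx
          refine Submodule.mul_induction_on hx ?_ ?_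
          · intro a ha b hb
            rw [d_mul]
            exact Submodule.add_mem _ (Submodule.mul_mem_mul (ih.1 ha) hb)
              (Submodule.mul_mem_mul (ih.2 ha) (I.d_mem hb))
          · intro b c hb hc; rw [map_add]; exact Submodule.add_mem _ hb hc
        · intro x hx
          refine Submodule.mul_induction_on hx ?_ ?_
          · intro a ha b hb
            rw [eps_mul]
            exact Submodule.mul_mem_mul (ih.2 ha) (heI hb)
          · intro b c hb hc; rw [map_add]; exact Submodule.add_mem _ hb hc
    intro a ha
    exact key.1 ha

/-- A differential ideal as a differential submodule. -/
def DGIdeal.toSub (I : A.DGIdeal) : A.self.Sub where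
  toSubmodule := I.toIdeal
  homogeneous := I.homogeneous
  d_mem := I.d_mem

end CDGA

/-! ### Tensor products of commutative cochain algebras -/

section Tensor

variable (A : CDGA.{u}) (B : CDGA.{v})

/-- The underlying algebra of `A ⊗ B`, with product
`(a ⊗ b)(a' ⊗ b') = (-1)^(|b||a'|) aa' ⊗ bb'`. -/
abbrev TensorCarrier : Type (max u v) := A.gr ᵍ⊗[ℚ] B.gr

instance : SMulCommClass ℚ (TensorCarrier A B) (TensorCarrier A B) :=
  ⟨fun r x y => (Algebra.mul_smul_comm r x y).symm⟩

/-- The element `a ⊗ b`. -/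
def tmk : A →ₗ[ℚ] B →ₗ[ℚ] TensorCarrier A B :=
  (TensorProduct.mk ℚ A B).compr₂ (GradedTensorProduct.of ℚ A.gr B.gr).toLinearMap

theorem units_smul_eq {M : Type u} [AddCommGroup M] [Module ℚ M] (n : ℤ) (x : M) :
    ((-1 : ℤˣ) ^ n) • x = ((-1 : ℚ) ^ n) • x := by
  rcases Int.even_or_odd n with h | h
  · rw [h.neg_one_zpow, h.neg_one_zpow, one_smul, one_smul]
  · rw [h.neg_one_zpow, h.neg_one_zpow, Units.neg_smul, neg_smul, one_smul, one_smul]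

theorem tmk_mul_tmk {q p : ℤ} (a : A) {b : B} (hb : b ∈ B.gr q) {a' : A} (ha' : a' ∈ A.gr p)
    (b' : B) : tmk A B a b * tmk A B a' b' =
      ((-1 : ℚ) ^ (q * p)) • tmk A B (a * a') (b * b') := by
  have h := GradedTensorProduct.tmul_coe_mul_coe_tmul (R := ℚ) A.gr B.gr a ⟨b, hb⟩ ⟨a', ha'⟩ b'
  refine h.trans ?_
  exact units_smul_eq _ _

/-- The component of degree `n` of `A ⊗ B`, spanned by the `a ⊗ b` with `|a| + |b| = n`. -/
def tensorGr (n : ℤ) : Submodule ℚ (TensorCarrier A B) :=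
  Submodule.span ℚ {x | ∃ p q : ℤ, p + q = n ∧ ∃ a ∈ A.gr p, ∃ b ∈ B.gr q, x = tmk A B a b}

theorem tmk_mem {p q : ℤ} {a : A} {b : B} (ha : a ∈ A.gr p) (hb : b ∈ B.gr q) :
    tmk A B a b ∈ tensorGr A B (p + q) :=
  Submodule.subset_span ⟨p, q, rfl, a, ha, b, hb, rfl⟩

/-- Two linear maps on `A ⊗ B` that agree on tensors of homogeneous elements are equal. -/
theorem tensor_induction {M : Type w} [AddCommGroup M] [Module ℚ M]
    {f g : TensorCarrier A B →ₗ[ℚ] M}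
    (h : ∀ p q, ∀ a ∈ A.gr p, ∀ b ∈ B.gr q, f (tmk A B a b) = g (tmk A B a b))
    (x : TensorCarrier A B) : f x = g x := by
  suffices f = g by rw [this]
  apply GradedTensorProduct.hom_ext
  apply TensorProduct.ext'
  intro a b
  refine homogeneous_induction A.internal (f := f ∘ₗ (tmk A B).flip b)
    (g := g ∘ₗ (tmk A B).flip b) ?_ a
  intro p a ha
  exact homogeneous_induction B.internal (f := f ∘ₗ tmk A B a) (g := g ∘ₗ tmk A B a)
    (fun q b hb => h p q a ha b hb) b

/-- The linear map on `A ⊗ B` induced by a bilinear map. -/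
def tensorLift {M : Type w} [AddCommGroup M] [Module ℚ M] (f : A →ₗ[ℚ] B →ₗ[ℚ] M) :
    TensorCarrier A B →ₗ[ℚ] M :=
  TensorProduct.lift f ∘ₗ (GradedTensorProduct.of ℚ A.gr B.gr).symm.toLinearMap

theorem tensorLift_tmk {M : Type w} [AddCommGroup M] [Module ℚ M] (f : A →ₗ[ℚ] B →ₗ[ℚ] M)
    (a : A) (b : B) : tensorLift A B f (tmk A B a b) = f a b := by
  exact TensorProduct.lift.tmul a b

theorem tensor_iSup : ⨆ n, tensorGr A B n = ⊤ := by
  rw [← Submodule.ker_mkQ (⨆ n, tensorGr A B n), LinearMap.ker_eq_top]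
  apply LinearMap.ext
  refine tensor_induction A B fun p q a ha b hb => ?_
  rw [LinearMap.zero_apply, Submodule.mkQ_apply, Submodule.Quotient.mk_eq_zero]
  exact Submodule.mem_iSup_of_mem _ (tmk_mem A B ha hb)

theorem nonneg_of_ne_zero {A : CDGA.{u}} {p : ℤ} {a : A} (ha : a ∈ A.gr p) (h0 : a ≠ 0) :
    0 ≤ p := by
  by_contra h
  rw [A.gr_neg p (by omega), Submodule.mem_bot] at ha
  exact h0 ha

theorem tensor_internal : DirectSum.IsInternal (tensorGr A B) := by
  have key : ∀ n p q : ℤ, ∀ a ∈ A.gr p, ∀ b ∈ B.gr q,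
      tensorLift A B (∑ i ∈ Finset.Icc 0 n,
        (tmk A B).compl₁₂ (proj A.internal i) (proj B.internal (n - i))) (tmk A B a b) =
      if p + q = n then tmk A B a b else 0 := by
    intro n p q a ha b hb
    rw [tensorLift_tmk]
    simp only [LinearMap.sum_apply, LinearMap.compl₁₂_apply]
    by_cases ha0 : a = 0
    · simp [ha0]
    by_cases hb0 : b = 0
    · simp [hb0]
    have hp := nonneg_of_ne_zero ha ha0
    have hq := nonneg_of_ne_zero hb hb0
    split_ifs with h
    · rw [Finset.sum_eq_single p]
      · rw [proj_of_mem _ ha, show n - p = q by omega, proj_of_mem _ hb]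
      · intro i _ hi
        rw [proj_of_mem_ne _ hi.symm ha, map_zero, LinearMap.zero_apply]
      · intro hi
        exact absurd (Finset.mem_Icc.2 ⟨hp, by omega⟩) hi
    · refine Finset.sum_eq_zero fun i _ => ?_
      by_cases hi : p = i
      · rw [proj_of_mem_ne B.internal (show q ≠ n - i by omega) hb, map_zero]
      · rw [proj_of_mem_ne A.internal hi ha, map_zero, LinearMap.zero_apply]
  refine isInternal_of_proj _ (fun n => tensorLift A B (∑ i ∈ Finset.Icc 0 n,
        (tmk A B).compl₁₂ (proj A.internal i) (proj B.internal (n - i)))) ?_ ?_ (tensor_iSup A B)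
  · intro n x hx
    refine Submodule.span_induction ?_ (by simp) (fun x y _ _ hx hy => by rw [map_add, hx, hy])
      (fun r x _ hx => by rw [map_smul, hx]) hx
    rintro _ ⟨p, q, hpq, a, ha, b, hb, rfl⟩
    rw [key n p q a ha b hb, if_pos hpq]
  · intro n m hnm x hx
    refine Submodule.span_induction ?_ (by simp)
      (fun x y _ _ hx hy => by rw [map_add, hx, hy, add_zero])
      (fun r x _ hx => by rw [map_smul, hx, smul_zero]) hx
    rintro _ ⟨p, q, hpq, a, ha, b, hb, rfl⟩
    rw [key n p q a ha b hb, if_neg (by omega)]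

instance : GradedAlgebra (tensorGr A B) where
  one_mem := by
    have := tmk_mem A B (SetLike.GradedOne.one_mem : (1 : A) ∈ A.gr 0)
      (SetLike.GradedOne.one_mem : (1 : B) ∈ B.gr 0)
    rwa [add_zero] at this
  mul_mem := by
    intro m n x y hx hy
    refine Submodule.span_induction ?_ (by rw [zero_mul]; exact Submodule.zero_mem _)
      (fun x x' _ _ hx hx' => by rw [add_mul]; exact Submodule.add_mem _ hx hx')
      (fun r x _ hx => by rw [smul_mul_assoc]; exact Submodule.smul_mem _ _ hx) hx
    rintro _ ⟨p, q, hpq, a, ha, b, hb, rfl⟩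
    refine Submodule.span_induction ?_ (by rw [mul_zero]; exact Submodule.zero_mem _)
      (fun x x' _ _ hx hx' => by rw [mul_add]; exact Submodule.add_mem _ hx hx')
      (fun r x _ hx => by rw [mul_smul_comm]; exact Submodule.smul_mem _ _ hx) hy
    rintro _ ⟨p', q', hpq', a', ha', b', hb', rfl⟩
    rw [tmk_mul_tmk A B a hb ha' b', show m + n = (p + p') + (q + q') by omega]
    exact Submodule.smul_mem _ _ (tmk_mem A B (SetLike.GradedMul.mul_mem ha ha')
      (SetLike.GradedMul.mul_mem hb hb'))
  toDecomposition := (tensor_internal A B).chooseDecomposition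

/-- The differential `d(a ⊗ b) = da ⊗ b + (-1)^|a| a ⊗ db`. -/
def tensorD : TensorCarrier A B →ₗ[ℚ] TensorCarrier A B :=
  tensorLift A B ((tmk A B).compl₁₂ A.d LinearMap.id + (tmk A B).compl₁₂ A.eps B.d)

theorem tensorD_tmk (a : A) (b : B) :
    tensorD A B (tmk A B a b) = tmk A B (A.d a) b + tmk A B (A.eps a) (B.d b) := by
  rw [tensorD, tensorLift_tmk]
  simp

theorem sgn_mul_self (p : ℤ) : ((-1 : ℚ) ^ p) * ((-1 : ℚ) ^ p) = 1 := by
  rw [← mul_zpow]; simp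

/-- The tensor product of commutative cochain algebras. -/
def CDGA.tensor : CDGA.{max u v} where
  carrier := TensorCarrier A B
  gr := tensorGr A B
  comm := by
    intro m n x y hx hy
    refine Submodule.span_induction ?_ (by simp)
      (fun x x' _ _ hx hx' => by rw [add_mul, mul_add, smul_add, hx, hx'])
      (fun r x _ hx => by rw [smul_mul_assoc, mul_smul_comm, hx, smul_comm]) hx
    rintro _ ⟨p, q, hpq, a, ha, b, hb, rfl⟩
    refine Submodule.span_induction ?_ (by simp)
      (fun x x' _ _ hx hx' => by rw [add_mul, mul_add, smul_add, hx, hx'])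
      (fun r x _ hx => by rw [smul_mul_assoc, mul_smul_comm, hx, smul_comm]) hy
    rintro _ ⟨p', q', hpq', a', ha', b', hb', rfl⟩
    rw [tmk_mul_tmk A B a hb ha' b', tmk_mul_tmk A B a' hb' ha b, A.comm ha ha', B.comm hb hb']
    simp only [map_smul, LinearMap.smul_apply, smul_smul]
    congr 1
    subst hpq hpq'
    have h := sgn_mul_self (q' * p)
    simp only [add_mul, mul_add, zpow_add₀ (show (-1 : ℚ) ≠ 0 by norm_num), mul_comm p q',
      mul_comm p p', mul_comm q p'] at h ⊢
    linear_combination (-((-1 : ℚ) ^ (p' * q) * (-1 : ℚ) ^ (p' * p) * (-1 : ℚ) ^ (q * q'))) * h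
  gr_neg := by
    intro n hn
    rw [tensorGr, Submodule.span_eq_bot]
    rintro _ ⟨p, q, hpq, a, ha, b, hb, rfl⟩
    by_cases ha0 : a = 0
    · rw [ha0, map_zero, LinearMap.zero_apply]
    by_cases hb0 : b = 0
    · rw [hb0, map_zero]
    have hp := nonneg_of_ne_zero ha ha0
    have hq := nonneg_of_ne_zero hb hb0
    omega
  d := tensorD A B
  d_mem := by
    intro n x hx
    refine Submodule.span_induction ?_ (by simp)
      (fun x x' _ _ hx hx' => by rw [map_add]; exact Submodule.add_mem _ hx hx')
      (fun r x _ hx => by rw [map_smul]; exact Submodule.smul_mem _ _ hx) hx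
    rintro _ ⟨p, q, hpq, a, ha, b, hb, rfl⟩
    rw [tensorD_tmk, A.eps_of_mem ha, map_smul, LinearMap.smul_apply]
    refine Submodule.add_mem _ ?_ (Submodule.smul_mem _ _ ?_)
    · rw [show n + 1 = (p + 1) + q by omega]
      exact tmk_mem A B (A.d_mem ha) hb
    · rw [show n + 1 = p + (q + 1) by omega]
      exact tmk_mem A B ha (B.d_mem hb)
  d_d := by
    refine tensor_induction A B (f := tensorD A B ∘ₗ tensorD A B) (g := 0) ?_
    intro p q a ha b hb
    simp [tensorD_tmk, A.d_d, B.d_d, A.d_eps]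
  leibniz := by
    intro n x hx y
    refine Submodule.span_induction (p := fun x _ => tensorD A B (x * y) =
        tensorD A B x * y + ((-1 : ℚ) ^ n) • (x * tensorD A B y)) ?_ (by simp)
      (fun x x' _ _ hx hx' => by
        simp only [add_mul, map_add, smul_add, hx, hx']; abel)
      (fun r x _ hx => by
        simp only [smul_mul_assoc, map_smul, hx, smul_add]
        rw [smul_comm]) hx
    rintro _ ⟨p, q, hpq, a, ha, b, hb, rfl⟩
    refine tensor_induction A B
      (f := tensorD A B ∘ₗ LinearMap.mul ℚ (TensorCarrier A B) (tmk A B a b))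
      (g := LinearMap.mul ℚ (TensorCarrier A B) (tensorD A B (tmk A B a b)) +
        ((-1 : ℚ) ^ n) • (LinearMap.mul ℚ (TensorCarrier A B) (tmk A B a b) ∘ₗ tensorD A B)) ?_ y
    intro p' q' a' ha' b' hb'
    simp only [LinearMap.comp_apply, LinearMap.mul_apply', LinearMap.add_apply,
      LinearMap.smul_apply, tensorD_tmk, A.eps_of_mem ha, A.eps_of_mem ha', map_smul,
      add_mul, mul_add, smul_mul_assoc, mul_smul_comm]
    rw [tmk_mul_tmk A B a hb ha' b', tmk_mul_tmk A B _ hb ha' b',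
      tmk_mul_tmk A B a (B.d_mem hb) ha' b', tmk_mul_tmk A B a hb (A.d_mem ha') b',
      tmk_mul_tmk A B a hb ha' (B.d b'), map_smul, tensorD_tmk, A.leibniz ha a', B.leibniz hb b',
      A.eps_of_mem (SetLike.GradedMul.mul_mem ha ha')]
    subst hpq
    simp only [map_add, map_smul, LinearMap.add_apply, LinearMap.smul_apply, smul_add, smul_smul,
      add_mul, mul_add, mul_one, one_mul, zpow_add₀ (show (-1 : ℚ) ≠ 0 by norm_num)]
    have e : (-1 : ℚ) ^ p * (-1) ^ q * ((-1) ^ (q * p') * (-1) ^ q) =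
        (-1) ^ (q * p') * (-1) ^ p := by
      linear_combination ((-1 : ℚ) ^ p * (-1) ^ (q * p')) * sgn_mul_self q
    rw [e]
    module

theorem CDGA.comm_units (A : CDGA.{u}) ⦃p q : ℤ⦄ (a : A.gr p) (b : A.gr q) :
    AlgHom.id ℚ A a * AlgHom.id ℚ A b =
      (-1 : ℤˣ) ^ (q * p) • (AlgHom.id ℚ A b * AlgHom.id ℚ A a) := by
  refine (A.comm a.2 b.2).trans ?_
  rw [mul_comm p q]
  exact (units_smul_eq _ _).symm

/-- The multiplication `μ : A ⊗ A → A`, a morphism of commutative cochain algebras. -/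
def CDGA.mu (A : CDGA.{u}) : CDGA.Hom (A.tensor A) A where
  toAlgHom := GradedTensorProduct.lift A.gr A.gr (AlgHom.id ℚ A) (AlgHom.id ℚ A) A.comm_units
  map_gr := by
    intro n x hx
    refine Submodule.span_induction (p := fun x _ => GradedTensorProduct.lift A.gr A.gr
      (AlgHom.id ℚ A) (AlgHom.id ℚ A) A.comm_units x ∈ A.gr n) ?_ (by rw [map_zero]; exact Submodule.zero_mem _)
      (fun x x' _ _ hx hx' => by rw [map_add]; exact Submodule.add_mem _ hx hx')
      (fun r x _ hx => by rw [map_smul]; exact Submodule.smul_mem _ _ hx) hx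
    rintro _ ⟨p, q, rfl, a, ha, b, hb, rfl⟩
    exact SetLike.GradedMul.mul_mem ha hb
  map_d := by
    intro x
    refine tensor_induction A A (f := (GradedTensorProduct.lift A.gr A.gr
      (AlgHom.id ℚ A) (AlgHom.id ℚ A) A.comm_units).toLinearMap ∘ₗ tensorD A A) (g := A.d ∘ₗ
      (GradedTensorProduct.lift A.gr A.gr (AlgHom.id ℚ A) (AlgHom.id ℚ A) A.comm_units).toLinearMap) ?_ x
    intro p q a ha b hb
    simp only [LinearMap.comp_apply, tensorD_tmk, map_add]
    exact (A.d_mul a b).symm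

end Tensor

/-! ### Polynomial differential forms on the standard simplices -/

/-- The generators `t_i` (degree `0`) and `dt_i` (degree `1`), `0 ≤ i ≤ n`. -/
inductive Gen (n : ℕ)
  | t (i : Fin (n + 1))
  | dt (i : Fin (n + 1))

/-- The degree of a generator. -/
def Gen.deg {n : ℕ} : Gen n → ℤ
  | .t _ => 0
  | .dt _ => 1

/-- The relations defining the polynomial forms on the `n`-simplex: graded commutativity,
`∑ t_i = 1` and `∑ dt_i = 0`. -/
inductive FormRel (n : ℕ) : FreeAlgebra ℚ (Gen n) → FreeAlgebra ℚ (Gen n) → Prop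
  | comm (x y : Gen n) : FormRel n (FreeAlgebra.ι ℚ x * FreeAlgebra.ι ℚ y)
      (((-1 : ℚ) ^ (x.deg * y.deg)) • (FreeAlgebra.ι ℚ y * FreeAlgebra.ι ℚ x))
  | sum_t : FormRel n (∑ i, FreeAlgebra.ι ℚ (Gen.t i)) 1
  | sum_dt : FormRel n (∑ i, FreeAlgebra.ι ℚ (Gen.dt i)) 0

/-- `(A_PL)_n = Λ(t_0, …, t_n, dt_0, …, dt_n) / (∑ t_i - 1, ∑ dt_i)`. -/
def Form (n : ℕ) : Type := RingQuot (FormRel n)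

namespace Form

instance (n : ℕ) : Ring (Form n) := inferInstanceAs (Ring (RingQuot (FormRel n)))
instance (n : ℕ) : Algebra ℚ (Form n) := inferInstanceAs (Algebra ℚ (RingQuot (FormRel n)))

variable {n : ℕ}

/-- The quotient map. -/
def mk : FreeAlgebra ℚ (Gen n) →ₐ[ℚ] Form n := RingQuot.mkAlgHom ℚ (FormRel n)

theorem mk_surjective : Function.Surjective (mk (n := n)) :=
  RingQuot.mkAlgHom_surjective ℚ (FormRel n)

theorem mk_rel {a b : FreeAlgebra ℚ (Gen n)} (h : FormRel n a b) : mk a = mk b :=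
  RingQuot.mkAlgHom_rel ℚ h

/-- The class of a generator. -/
def gen (x : Gen n) : Form n := mk (FreeAlgebra.ι ℚ x)

theorem gen_comm (x y : Gen n) :
    gen x * gen y = ((-1 : ℚ) ^ (x.deg * y.deg)) • (gen y * gen x) := by
  have h := mk_rel (FormRel.comm x y)
  rwa [map_mul, map_smul, map_mul] at h

theorem sum_t : ∑ i, gen (Gen.t i : Gen n) = 1 := by
  have h := mk_rel (FormRel.sum_t (n := n))
  rwa [map_sum, map_one] at h

theorem sum_dt : ∑ i, gen (Gen.dt i : Gen n) = 0 := by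
  have h := mk_rel (FormRel.sum_dt (n := n))
  rwa [map_sum, map_zero] at h

/-- The universal property of the algebra of polynomial forms. -/
def lift {B : Type u} [Ring B] [Algebra ℚ B] (f : Gen n → B)
    (hc : ∀ x y, f x * f y = ((-1 : ℚ) ^ (x.deg * y.deg)) • (f y * f x))
    (ht : ∑ i, f (Gen.t i) = 1) (hdt : ∑ i, f (Gen.dt i) = 0) : Form n →ₐ[ℚ] B :=
  RingQuot.liftAlgHom ℚ ⟨FreeAlgebra.lift ℚ f, by
    rintro _ _ (⟨x, y⟩ | _ | _)
    · simpa using hc x y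
    · simpa using ht
    · simpa using hdt⟩

theorem lift_gen {B : Type u} [Ring B] [Algebra ℚ B] (f : Gen n → B) (hc ht hdt) (x : Gen n) :
    lift f hc ht hdt (gen x) = f x := by
  refine (RingQuot.liftAlgHom_mkAlgHom_apply ℚ _ _ _).trans ?_
  simp

/-- The class of a word in the generators. -/
def word (l : List (Gen n)) : Form n := (l.map gen).prod

/-- The degree of a word. -/
def wdeg (l : List (Gen n)) : ℤ := (l.map Gen.deg).sum

/-- The forms of degree `p`: the span of the words in the `t_i`, `dt_i` of degree `p`. -/
def gr (n : ℕ) (p : ℤ) : Submodule ℚ (Form n) :=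
  Submodule.span ℚ {x | ∃ l : List (Gen n), wdeg l = p ∧ x = word l}

theorem word_nil : word ([] : List (Gen n)) = 1 := rfl

theorem word_cons (x : Gen n) (l : List (Gen n)) : word (x :: l) = gen x * word l := by
  simp [word]

theorem word_append (l l' : List (Gen n)) : word (l ++ l') = word l * word l' := by
  simp [word]

theorem wdeg_cons (x : Gen n) (l : List (Gen n)) : wdeg (x :: l) = x.deg + wdeg l := by
  simp [wdeg]

theorem wdeg_append (l l' : List (Gen n)) : wdeg (l ++ l') = wdeg l + wdeg l' := by
  simp [wdeg]

theorem word_mem (l : List (Gen n)) : word l ∈ gr n (wdeg l) :=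
  Submodule.subset_span ⟨l, rfl, rfl⟩

theorem gen_mem (x : Gen n) : gen x ∈ gr n x.deg := by
  simpa [word, wdeg] using word_mem [x]

theorem one_mem : (1 : Form n) ∈ gr n 0 := word_mem []

theorem gr_induction {p : ℤ} {P : Form n → Prop} {x : Form n} (hx : x ∈ gr n p)
    (hw : ∀ l, wdeg l = p → P (word l)) (h0 : P 0) (ha : ∀ x y, P x → P y → P (x + y))
    (hs : ∀ (r : ℚ) x, P x → P (r • x)) : P x := by
  refine Submodule.span_induction (p := fun x _ => P x) ?_ h0 (fun x y _ _ => ha x y)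
    (fun r x _ => hs r x) hx
  rintro _ ⟨l, hl, rfl⟩
  exact hw l hl

theorem mul_mem {p q : ℤ} {a b : Form n} (ha : a ∈ gr n p) (hb : b ∈ gr n q) :
    a * b ∈ gr n (p + q) := by
  refine gr_induction ha (P := fun a => a * b ∈ gr n (p + q)) ?_
    (by rw [zero_mul]; exact Submodule.zero_mem _)
    (fun x y hx hy => by rw [add_mul]; exact Submodule.add_mem _ hx hy)
    (fun r x hx => by rw [smul_mul_assoc]; exact Submodule.smul_mem _ _ hx)
  rintro l rfl
  refine gr_induction hb (P := fun b => word l * b ∈ gr n (wdeg l + q)) ?_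
    (by rw [mul_zero]; exact Submodule.zero_mem _)
    (fun x y hx hy => by rw [mul_add]; exact Submodule.add_mem _ hx hy)
    (fun r x hx => by rw [mul_smul_comm]; exact Submodule.smul_mem _ _ hx)
  rintro l' rfl
  rw [← word_append, ← wdeg_append]
  exact word_mem _

/-- The words span. -/
theorem span_words : Submodule.span ℚ (Set.range (word (n := n))) = ⊤ := by
  rw [eq_top_iff]
  rintro x -
  obtain ⟨y, rfl⟩ := mk_surjective x
  induction y using FreeAlgebra.induction with
  | grade0 r =>
    rw [AlgHom.commutes, Algebra.algebraMap_eq_smul_one]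
    exact Submodule.smul_mem _ _ (Submodule.subset_span ⟨[], rfl⟩)
  | grade1 x => exact Submodule.subset_span ⟨[x], by simp [word, gen]⟩
  | add a b ha hb => rw [map_add]; exact Submodule.add_mem _ ha hb
  | mul a b ha hb =>
    rw [map_mul]
    refine Submodule.span_induction (p := fun a _ => a * mk b ∈ _) ?_ ?_ ?_ ?_ ha
    · rintro _ ⟨l, rfl⟩
      refine Submodule.span_induction (p := fun b _ => word l * b ∈ _) ?_ ?_ ?_ ?_ hb
      · rintro _ ⟨l', rfl⟩
        exact Submodule.subset_span ⟨l ++ l', word_append l l'⟩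
      · rw [mul_zero]; exact Submodule.zero_mem _
      · intro x y _ _ hx hy; rw [mul_add]; exact Submodule.add_mem _ hx hy
      · intro r x _ hx; rw [mul_smul_comm]; exact Submodule.smul_mem _ _ hx
    · rw [zero_mul]; exact Submodule.zero_mem _
    · intro x y _ _ hx hy; rw [add_mul]; exact Submodule.add_mem _ hx hy
    · intro r x _ hx; rw [smul_mul_assoc]; exact Submodule.smul_mem _ _ hx

theorem word_induction {M : Type u} [AddCommGroup M] [Module ℚ M] {f g : Form n →ₗ[ℚ] M}
    (h : ∀ l, f (word l) = g (word l)) (x : Form n) : f x = g x := by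
  have : (⊤ : Submodule ℚ (Form n)) ≤ LinearMap.eqLocus f g := by
    rw [← span_words, Submodule.span_le]
    rintro _ ⟨l, rfl⟩
    exact h l
  exact this (Submodule.mem_top : x ∈ ⊤)

theorem iSup_gr : ⨆ p, gr n p = ⊤ := by
  rw [eq_top_iff, ← span_words, Submodule.span_le]
  rintro _ ⟨l, rfl⟩
  exact Submodule.mem_iSup_of_mem _ (word_mem l)

/-- The coaction `x ↦ x T^|x|` that detects the degree. -/
def coact : Form n →ₐ[ℚ] AddMonoidAlgebra (Form n) ℤ :=
  lift (fun x => AddMonoidAlgebra.single x.deg (gen x))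
    (fun x y => by
      rw [AddMonoidAlgebra.single_mul_single, AddMonoidAlgebra.single_mul_single, gen_comm,
        AddMonoidAlgebra.smul_single, add_comm])
    (by
      change ∑ i, AddMonoidAlgebra.single (0 : ℤ) (gen (Gen.t i)) = 1
      have h := map_sum (AddMonoidAlgebra.singleAddHom (R := Form n) (0 : ℤ))
        (fun i => gen (Gen.t i)) Finset.univ
      rw [sum_t] at h
      exact h.symm)
    (by
      change ∑ i, AddMonoidAlgebra.single (1 : ℤ) (gen (Gen.dt i)) = 0
      have h := map_sum (AddMonoidAlgebra.singleAddHom (R := Form n) (1 : ℤ))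
        (fun i => gen (Gen.dt i)) Finset.univ
      rw [sum_dt, map_zero] at h
      exact h.symm)

theorem coact_word (l : List (Gen n)) :
    coact (word l) = AddMonoidAlgebra.single (wdeg l) (word l) := by
  induction l with
  | nil => rw [word_nil, map_one]; rfl
  | cons x l ih =>
    rw [word_cons, map_mul, ih, coact, lift_gen, AddMonoidAlgebra.single_mul_single, wdeg_cons]

theorem internal : DirectSum.IsInternal (gr n) := by
  have hl : ∀ (p : ℤ), ∀ x ∈ gr n p, coact x = AddMonoidAlgebra.single p x := by
    intro p x hx
    refine gr_induction hx (P := fun x => coact x = AddMonoidAlgebra.single p x) ?_ (by simp)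
      (fun x y hx hy => by rw [map_add, hx, hy, AddMonoidAlgebra.single_add])
      (fun r x hx => by rw [map_smul, hx, AddMonoidAlgebra.smul_single])
    rintro l rfl
    exact coact_word l
  refine isInternal_of_proj _ (fun p =>
    { toFun := fun x => (coact x).coeff p
      map_add' := fun x y => by simp
      map_smul' := fun r x => by simp }) ?_ ?_ iSup_gr
  · intro p x hx
    change (coact x).coeff p = x
    rw [hl p x hx, AddMonoidAlgebra.coeff_single, Finsupp.single_eq_same]
  · intro p q hpq x hx
    change (coact x).coeff p = 0
    rw [hl q x hx, AddMonoidAlgebra.coeff_single, Finsupp.single_eq_of_ne hpq.symm]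

instance : GradedAlgebra (gr n) where
  one_mem := one_mem
  mul_mem := fun _ _ _ _ ha hb => mul_mem ha hb
  toDecomposition := internal.chooseDecomposition

theorem gen_word_comm (x : Gen n) (l : List (Gen n)) :
    gen x * word l = ((-1 : ℚ) ^ (x.deg * wdeg l)) • (word l * gen x) := by
  induction l with
  | nil => simp [word, wdeg]
  | cons y l ih =>
    rw [word_cons, wdeg_cons, ← mul_assoc, gen_comm, smul_mul_assoc, mul_assoc, ih, mul_smul_comm,
      smul_smul, mul_add, zpow_add₀ (by norm_num), mul_assoc]

theorem word_comm (l l' : List (Gen n)) :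
    word l * word l' = ((-1 : ℚ) ^ (wdeg l * wdeg l')) • (word l' * word l) := by
  induction l with
  | nil => simp [word, wdeg]
  | cons y l ih =>
    rw [word_cons, wdeg_cons, mul_assoc, ih, mul_smul_comm, ← mul_assoc, gen_word_comm,
      smul_mul_assoc, smul_smul, add_mul, zpow_add₀ (by norm_num), mul_assoc, mul_comm]

theorem form_comm {p q : ℤ} {a b : Form n} (ha : a ∈ gr n p) (hb : b ∈ gr n q) :
    a * b = ((-1 : ℚ) ^ (p * q)) • (b * a) := by
  refine gr_induction ha (P := fun a => a * b = ((-1 : ℚ) ^ (p * q)) • (b * a)) ?_ (by simp)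
    (fun x y hx hy => by rw [add_mul, mul_add, smul_add, hx, hy])
    (fun r x hx => by rw [smul_mul_assoc, mul_smul_comm, hx, smul_comm])
  rintro l rfl
  refine gr_induction hb (P := fun b => word l * b = ((-1 : ℚ) ^ (wdeg l * q)) • (b * word l)) ?_
    (by simp)
    (fun x y hx hy => by rw [add_mul, mul_add, smul_add, hx, hy])
    (fun r x hx => by rw [smul_mul_assoc, mul_smul_comm, hx, smul_comm])
  rintro l' rfl
  exact word_comm l l'

/-- The differential on generators: `t_i ↦ dt_i`, `dt_i ↦ 0`. -/
def dgen : Gen n → Form n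
  | .t i => gen (.dt i)
  | .dt _ => 0

/-- The representation `x ↦ ((-1)^|x| x, dx; 0, x)` that encodes the differential. -/
def rep : Form n →ₐ[ℚ] Matrix (Fin 2) (Fin 2) (Form n) :=
  lift (fun x => !![((-1 : ℚ) ^ x.deg) • gen x, dgen x; 0, gen x])
    (by
      have hc := gen_comm (n := n)
      rintro (i | i) (j | j)
      · have h1 := hc (.t i) (.t j)
        have h2 := hc (.t i) (.dt j)
        have h3 := hc (.dt i) (.t j)
        simp only [Gen.deg, mul_zero, zero_mul, zpow_zero, one_smul] at h1 h2 h3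
        simp only [Gen.deg, mul_zero, zpow_zero, one_smul, dgen, Matrix.mul_fin_two]
        simp [h1, h2, h3, add_comm]
      · have h1 := hc (.t i) (.dt j)
        have h2 := hc (.dt i) (.dt j)
        simp only [Gen.deg, mul_one, zpow_zero, one_smul, zpow_one, neg_smul] at h1 h2
        simp only [Gen.deg, mul_one, zpow_zero, one_smul, dgen, Matrix.mul_fin_two]
        simp [h1, h2]
      · have h1 := hc (.dt i) (.t j)
        have h2 := hc (.dt i) (.dt j)
        simp only [Gen.deg, mul_zero, mul_one, zpow_zero, one_smul, zpow_one, neg_smul] at h1 h2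
        simp only [Gen.deg, mul_zero, zpow_zero, one_smul, dgen, Matrix.mul_fin_two]
        simp [h1, h2]
      · have h2 := hc (.dt i) (.dt j)
        simp only [Gen.deg, mul_one, one_smul, zpow_one, neg_smul] at h2
        simp only [Gen.deg, mul_one, zpow_one, dgen, Matrix.mul_fin_two]
        simp [h2])
    (by
      have h1 := sum_t (n := n)
      have h2 := sum_dt (n := n)
      ext i j
      fin_cases i <;> fin_cases j <;> simp [Matrix.sum_apply, Gen.deg, dgen, h1, h2])
    (by
      have h2 := sum_dt (n := n)
      ext i j
      fin_cases i <;> fin_cases j <;> simp [Matrix.sum_apply, Gen.deg, dgen, h2])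

/-- The exterior derivative, the derivation with `t_i ↦ dt_i` and `dt_i ↦ 0`. -/
def d (n : ℕ) : Form n →ₗ[ℚ] Form n :=
  Matrix.entryLinearMap ℚ (Form n) (0 : Fin 2) (1 : Fin 2) ∘ₗ rep.toLinearMap

theorem rep_word (l : List (Gen n)) :
    rep (word l) = !![((-1 : ℚ) ^ wdeg l) • word l, d n (word l); 0, word l] := by
  have h : rep (word l) 0 0 = ((-1 : ℚ) ^ wdeg l) • word l ∧ rep (word l) 1 0 = 0 ∧
      rep (word l) 1 1 = word l := by
    induction l with
    | nil => simp [word, wdeg]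
    | cons x l ih =>
      obtain ⟨h0, h1, h2⟩ := ih
      rw [word_cons, map_mul, rep, lift_gen, ← rep]
      simp [Matrix.mul_apply, Fin.sum_univ_two, h0, h1, h2, wdeg_cons, smul_smul,
        zpow_add₀ (show (-1 : ℚ) ≠ 0 by norm_num), mul_comm]
  ext i j
  fin_cases i <;> fin_cases j
  · exact h.1
  · rfl
  · exact h.2.1
  · exact h.2.2

theorem d_gen (x : Gen n) : d n (gen x) = dgen x := by
  change rep (gen x) 0 1 = _
  rw [rep, lift_gen]
  rfl

theorem d_word_mul (l l' : List (Gen n)) : d n (word l * word l') =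
    d n (word l) * word l' + ((-1 : ℚ) ^ wdeg l) • (word l * d n (word l')) := by
  change rep (word l * word l') 0 1 = _
  rw [map_mul, rep_word, rep_word]
  simp [Matrix.mul_apply, Fin.sum_univ_two, add_comm]

theorem leibniz {p : ℤ} {a : Form n} (ha : a ∈ gr n p) (b : Form n) :
    d n (a * b) = d n a * b + ((-1 : ℚ) ^ p) • (a * d n b) := by
  refine gr_induction ha
    (P := fun a => d n (a * b) = d n a * b + ((-1 : ℚ) ^ p) • (a * d n b)) ?_ (by simp)
    (fun x y hx hy => by simp only [add_mul, map_add, smul_add, hx, hy]; abel)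
    (fun r x hx => by
      simp only [smul_mul_assoc, map_smul, hx, smul_add]
      rw [smul_comm])
  rintro l rfl
  refine word_induction (f := d n ∘ₗ LinearMap.mul ℚ (Form n) (word l))
    (g := LinearMap.mul ℚ (Form n) (d n (word l)) +
      ((-1 : ℚ) ^ wdeg l) • (LinearMap.mul ℚ (Form n) (word l) ∘ₗ d n)) ?_ b
  intro l'
  simpa using d_word_mul l l'

theorem d_gen_mem (x : Gen n) : d n (gen x) ∈ gr n (x.deg + 1) := by
  rw [d_gen]
  rcases x with i | i
  · exact gen_mem (.dt i)
  · exact Submodule.zero_mem _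

theorem d_one : d n 1 = 0 := by
  have h := leibniz (one_mem (n := n)) 1
  simpa using h

theorem d_word_mem (l : List (Gen n)) : d n (word l) ∈ gr n (wdeg l + 1) := by
  induction l with
  | nil => rw [word_nil, d_one]; exact Submodule.zero_mem _
  | cons x l ih =>
    rw [word_cons, leibniz (gen_mem x), wdeg_cons]
    refine Submodule.add_mem _ ?_ (Submodule.smul_mem _ _ ?_)
    · rw [add_right_comm]; exact mul_mem (d_gen_mem x) (word_mem l)
    · rw [add_assoc]; exact mul_mem (gen_mem x) ih

theorem d_mem {p : ℤ} {a : Form n} (ha : a ∈ gr n p) : d n a ∈ gr n (p + 1) := by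
  refine gr_induction ha (P := fun a => d n a ∈ gr n (p + 1)) ?_
    (by rw [map_zero]; exact Submodule.zero_mem _)
    (fun x y hx hy => by rw [map_add]; exact Submodule.add_mem _ hx hy)
    (fun r x hx => by rw [map_smul]; exact Submodule.smul_mem _ _ hx)
  rintro l rfl
  exact d_word_mem l

theorem d_d (a : Form n) : d n (d n a) = 0 := by
  refine word_induction (f := d n ∘ₗ d n) (g := 0) ?_ a
  intro l
  simp only [LinearMap.comp_apply, LinearMap.zero_apply]
  induction l with
  | nil => rw [word_nil, d_one, map_zero]
  | cons x l ih =>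
    have hx : d n (d n (gen x)) = 0 := by
      rcases x with i | i
      · rw [d_gen]; exact d_gen _
      · rw [d_gen]; exact map_zero _
    rw [word_cons, leibniz (gen_mem x), map_add, map_smul, leibniz (gen_mem x),
      leibniz (d_gen_mem x), hx, ih, zpow_add₀ (by norm_num)]
    simp

theorem gr_neg (p : ℤ) (hp : p < 0) : gr n p = ⊥ := by
  rw [gr, Submodule.span_eq_bot]
  rintro _ ⟨l, rfl, rfl⟩
  have h : 0 ≤ wdeg l := List.sum_nonneg (by
    intro x hx
    obtain ⟨y, -, rfl⟩ := List.mem_map.1 hx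
    rcases y with i | i
    · exact le_refl _
    · exact zero_le_one)
  omega

/-- The image of a generator under the map induced by `θ : {0, …, m} → {0, …, n}`:
`t_i ↦ ∑_{θ j = i} t_j`, `dt_i ↦ ∑_{θ j = i} dt_j`. -/
def pullGen {m : ℕ} (θ : Fin (m + 1) → Fin (n + 1)) : Gen n → Form m
  | .t i => ∑ j with θ j = i, gen (.t j)
  | .dt i => ∑ j with θ j = i, gen (.dt j)

theorem pullGen_mem {m : ℕ} (θ : Fin (m + 1) → Fin (n + 1)) (x : Gen n) :
    pullGen θ x ∈ gr m x.deg := by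
  rcases x with i | i
  · exact Submodule.sum_mem _ fun j _ => gen_mem (.t j)
  · exact Submodule.sum_mem _ fun j _ => gen_mem (.dt j)

/-- The pullback of polynomial forms along the affine map of simplices given on vertices by `θ`. -/
def pull {m : ℕ} (θ : Fin (m + 1) → Fin (n + 1)) : Form n →ₐ[ℚ] Form m :=
  lift (pullGen θ) (fun x y => form_comm (pullGen_mem θ x) (pullGen_mem θ y))
    (by
      rw [← sum_t]
      exact Finset.sum_fiberwise Finset.univ θ fun j => gen (Gen.t j))
    (by
      rw [← sum_dt (n := m)]
      exact Finset.sum_fiberwise Finset.univ θ fun j => gen (Gen.dt j))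

theorem pull_word_mem {m : ℕ} (θ : Fin (m + 1) → Fin (n + 1)) (l : List (Gen n)) :
    pull θ (word l) ∈ gr m (wdeg l) := by
  induction l with
  | nil => rw [word_nil, map_one]; exact one_mem
  | cons x l ih =>
    rw [word_cons, map_mul, wdeg_cons]
    refine mul_mem ?_ ih
    rw [pull, lift_gen]
    exact pullGen_mem θ x

theorem pull_d {m : ℕ} (θ : Fin (m + 1) → Fin (n + 1)) (a : Form n) :
    pull θ (d n a) = d m (pull θ a) := by
  refine word_induction (f := (pull θ).toLinearMap ∘ₗ d n) (g := d m ∘ₗ (pull θ).toLinearMap) ?_ a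
  intro l
  simp only [LinearMap.comp_apply, AlgHom.toLinearMap_apply]
  induction l with
  | nil => rw [word_nil, d_one, map_zero, map_one, d_one]
  | cons x l ih =>
    have hx : pull θ (d n (gen x)) = d m (pull θ (gen x)) := by
      rw [d_gen]
      conv_rhs => rw [pull, lift_gen]
      rcases x with i | i
      · simp [dgen, pull, lift_gen, pullGen, d_gen]
      · simp [dgen, pullGen, d_gen]
    have hm : pull θ (gen x) ∈ gr m x.deg := by
      rw [pull, lift_gen]; exact pullGen_mem θ x
    rw [word_cons, leibniz (gen_mem x), map_add, map_smul, map_mul, map_mul, map_mul,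
      leibniz hm, hx, ih]

end Form

/-! ### The cochain algebra `A_PL(X)` -/

theorem lof_internal (V : ℤ → Type u) [∀ p, AddCommGroup (V p)] [∀ p, Module ℚ (V p)] :
    DirectSum.IsInternal fun p => LinearMap.range (DirectSum.lof ℚ ℤ V p) := by
  refine isInternal_of_proj _ (fun p => DirectSum.lof ℚ ℤ V p ∘ₗ DirectSum.component ℚ ℤ V p)
    ?_ ?_ ?_
  · rintro p _ ⟨f, rfl⟩
    exact congrArg (DirectSum.lof ℚ ℤ V p) (DirectSum.component.lof_self ℚ p f)
  · rintro p q hpq _ ⟨f, rfl⟩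
    rw [LinearMap.comp_apply, DirectSum.component.of, dif_neg hpq, map_zero]
  · rw [eq_top_iff]
    rintro x -
    induction x using DirectSum.induction_on with
    | zero => exact Submodule.zero_mem _
    | of p f => exact Submodule.mem_iSup_of_mem p ⟨f, rfl⟩
    | add x y hx hy => exact Submodule.add_mem _ hx hy

section APL

open CategoryTheory Opposite

variable (K : SSet.{u})

/-- Families assigning to each simplex of `K` a polynomial form on the corresponding standard
simplex. -/
abbrev FormFamily : Type u := ∀ n : SimplexCategory, K.obj (op n) → Form n.len

/-- `A_PL^p(K)`: the families of polynomial `p`-forms, indexed by the simplices of `K`, that are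
compatible with the face and degeneracy operators. -/
def aplGr (p : ℤ) : Submodule ℚ (FormFamily K) where
  carrier := {f | (∀ n σ, f n σ ∈ Form.gr n.len p) ∧
    ∀ (m n : SimplexCategory) (θ : m ⟶ n) (σ : K.obj (op n)),
      f m (K.map θ.op σ) = Form.pull θ.toOrderHom (f n σ)}
  add_mem' := fun {f g} hf hg => ⟨fun n σ => Submodule.add_mem _ (hf.1 n σ) (hg.1 n σ),
    fun m n θ σ => by
      simp only [Pi.add_apply, map_add, hf.2 m n θ σ, hg.2 m n θ σ]⟩
  zero_mem' := ⟨fun _ _ => Submodule.zero_mem _, fun m n θ σ => by simp⟩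
  smul_mem' := fun r f hf => ⟨fun n σ => Submodule.smul_mem _ _ (hf.1 n σ),
    fun m n θ σ => by simp only [Pi.smul_apply, map_smul, hf.2 m n θ σ]⟩

instance : SetLike.GradedMonoid (aplGr K) where
  one_mem := ⟨fun _ _ => Form.one_mem, fun m n θ σ => by simp⟩
  mul_mem := fun p q f g hf hg => ⟨fun n σ => Form.mul_mem (hf.1 n σ) (hg.1 n σ),
    fun m n θ σ => by simp only [Pi.mul_apply, map_mul, hf.2 m n θ σ, hg.2 m n θ σ]⟩

/-- The simplexwise differential. -/
def aplD (p : ℤ) : aplGr K p →ₗ[ℚ] aplGr K (p + 1) where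
  toFun f := ⟨fun n σ => Form.d n.len (f.1 n σ), fun n σ => Form.d_mem (f.2.1 n σ),
    fun m n θ σ => by
      change Form.d m.len (f.1 m (K.map θ.op σ)) = Form.pull θ.toOrderHom (Form.d n.len (f.1 n σ))
      rw [f.2.2 m n θ σ, Form.pull_d]⟩
  map_add' f g := Subtype.ext (by funext n σ; exact map_add _ _ _)
  map_smul' r f := Subtype.ext (by funext n σ; exact (Form.d n.len).map_smul r (f.1 n σ))

/-- The underlying algebra `⨁ₚ A_PL^p(K)`. -/
abbrev AplCarrier : Type u := ⨁ p : ℤ, aplGr K p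

/-- The inclusion of the forms of degree `p`. -/
abbrev aplOf (p : ℤ) : aplGr K p →ₗ[ℚ] AplCarrier K := DirectSum.lof ℚ ℤ (fun p => aplGr K p) p

theorem aplOf_mul {p q : ℤ} (f : aplGr K p) (g : aplGr K q) :
    aplOf K p f * aplOf K q g =
      aplOf K (p + q) ⟨f.1 * g.1, SetLike.GradedMul.mul_mem f.2 g.2⟩ := by
  rw [DirectSum.lof_eq_of, DirectSum.lof_eq_of, DirectSum.lof_eq_of]
  exact DirectSum.of_mul_of (A := fun p => aplGr K p) f g

theorem aplOf_eq {p q : ℤ} (h : p = q) (f : aplGr K p) (g : aplGr K q) (hfg : f.1 = g.1) :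
    aplOf K p f = aplOf K q g := by
  subst h
  rw [Subtype.ext hfg]

theorem apl_internal : DirectSum.IsInternal fun p => LinearMap.range (aplOf K p) :=
  lof_internal fun p => aplGr K p

instance : GradedAlgebra fun p => LinearMap.range (aplOf K p) where
  one_mem := ⟨⟨1, SetLike.GradedOne.one_mem⟩, rfl⟩
  mul_mem := by
    rintro p q _ _ ⟨f, rfl⟩ ⟨g, rfl⟩
    rw [aplOf_mul]
    exact ⟨_, rfl⟩
  toDecomposition := (apl_internal K).chooseDecomposition

/-- The differential of `A_PL(K)`. -/
def aplTotalD : AplCarrier K →ₗ[ℚ] AplCarrier K :=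
  DirectSum.toModule ℚ ℤ _ fun p => aplOf K (p + 1) ∘ₗ aplD K p

theorem aplTotalD_of {p : ℤ} (f : aplGr K p) :
    aplTotalD K (aplOf K p f) = aplOf K (p + 1) (aplD K p f) := by
  simp [aplTotalD]

/-- The commutative cochain algebra `A_PL(K)` of polynomial forms on a simplicial set. -/
def aplSSet : CDGA.{u} where
  carrier := AplCarrier K
  gr p := LinearMap.range (aplOf K p)
  comm := by
    rintro p q _ _ ⟨f, rfl⟩ ⟨g, rfl⟩
    rw [aplOf_mul, aplOf_mul, ← map_smul]
    refine aplOf_eq K (add_comm p q) _ _ ?_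
    funext n σ
    exact Form.form_comm (f.2.1 n σ) (g.2.1 n σ)
  gr_neg := by
    intro p hp
    rw [LinearMap.range_eq_bot]
    ext1 f
    have : f = 0 := by
      apply Subtype.ext
      funext n σ
      have h := f.2.1 n σ
      rwa [Form.gr_neg p hp, Submodule.mem_bot] at h
    rw [this, map_zero, map_zero]
  d := aplTotalD K
  d_mem := by
    rintro p _ ⟨f, rfl⟩
    rw [aplTotalD_of]
    exact ⟨_, rfl⟩
  d_d := by
    intro x
    induction x using DirectSum.induction_on with
    | zero => simp
    | of p f =>
      change aplTotalD K (aplTotalD K (aplOf K p f)) = 0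
      rw [aplTotalD_of, aplTotalD_of]
      have : aplD K (p + 1) (aplD K p f) = 0 :=
        Subtype.ext (by funext n σ; exact Form.d_d _)
      rw [this, map_zero]
    | add x y hx hy => rw [map_add, map_add, hx, hy, add_zero]
  leibniz := by
    rintro p _ ⟨f, rfl⟩ b
    induction b using DirectSum.induction_on with
    | zero => simp
    | of q g =>
      change aplTotalD K (aplOf K p f * aplOf K q g) = aplTotalD K (aplOf K p f) * aplOf K q g +
        ((-1 : ℚ) ^ p) • (aplOf K p f * aplTotalD K (aplOf K q g))
      rw [aplOf_mul, aplTotalD_of, aplTotalD_of, aplTotalD_of, aplOf_mul, aplOf_mul,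
        aplOf_eq K (show p + (q + 1) = p + q + 1 by omega) _
          ⟨f.1 * (aplD K q g).1, by
            rw [show p + q + 1 = p + (q + 1) by omega]
            exact SetLike.GradedMul.mul_mem f.2 (aplD K q g).2⟩ rfl,
        aplOf_eq K (show p + 1 + q = p + q + 1 by omega) _
          ⟨(aplD K p f).1 * g.1, by
            rw [show p + q + 1 = p + 1 + q by omega]
            exact SetLike.GradedMul.mul_mem (aplD K p f).2 g.2⟩ rfl,
        ← map_smul, ← map_add]
      congr 1
      apply Subtype.ext
      funext n σ
      exact Form.leibniz (f.2.1 n σ) _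
    | add x y hx hy => simp only [mul_add, map_add, smul_add, hx, hy]; abel

/-- Sullivan's cochain algebra `A_PL(X)` of polynomial forms on the singular simplices of `X`. -/
def apl (X : Type u) [TopologicalSpace X] : CDGA.{u} := aplSSet (TopCat.toSSet.obj (TopCat.of X))

/-- The rational cohomology algebra `H^*(X) = H(A_PL(X))` of a space. -/
def rationalCohomology (X : Type u) [TopologicalSpace X] : CGA.{u} := (apl X).cohomology

end APL

/-! ### Sullivan models -/

/-- Graded commutativity `v w = (-1)^(|v||w|) w v` in the tensor algebra of a graded vector
space. -/
inductive LambdaRel (V : ℤ → Type u) [∀ p, AddCommGroup (V p)] [∀ p, Module ℚ (V p)] :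
    TensorAlgebra ℚ (⨁ p, V p) → TensorAlgebra ℚ (⨁ p, V p) → Prop
  | comm {p q : ℤ} (v : V p) (w : V q) : LambdaRel V
      (TensorAlgebra.ι ℚ (DirectSum.lof ℚ ℤ V p v) * TensorAlgebra.ι ℚ (DirectSum.lof ℚ ℤ V q w))
      (((-1 : ℚ) ^ (p * q)) • (TensorAlgebra.ι ℚ (DirectSum.lof ℚ ℤ V q w) *
        TensorAlgebra.ι ℚ (DirectSum.lof ℚ ℤ V p v)))

/-- The free commutative graded algebra `ΛV` on a graded vector space. -/
abbrev Lambda (V : ℤ → Type u) [∀ p, AddCommGroup (V p)] [∀ p, Module ℚ (V p)] : Type u :=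
  RingQuot (LambdaRel V)

/-- The canonical algebra map `ΛV → A` for a graded subspace `V` of a commutative graded
algebra `A`. -/
def lambdaMap (A : CGA.{u}) (V : ℤ → Submodule ℚ A) (hV : ∀ p, V p ≤ A.gr p) :
    Lambda (fun p => V p) →ₐ[ℚ] A :=
  RingQuot.liftAlgHom ℚ ⟨TensorAlgebra.lift ℚ (DirectSum.coeLinearMap V), by
    rintro _ _ ⟨v, w⟩
    simpa using A.comm (hV _ v.2) (hV _ w.2)⟩

/-- `(A, d)` is a Sullivan algebra: `A = ΛV` for a graded subspace `V` concentrated in degrees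
`≥ 1`, and `V` is the union of an increasing sequence of graded subspaces `V(0) ⊂ V(1) ⊂ ⋯` with
`d = 0` on `V(0)` and `d V(k + 1) ⊂ ΛV(k)`. -/
def CDGA.IsSullivanAlgebra (A : CDGA.{u}) : Prop :=
  ∃ (V : ℤ → Submodule ℚ A) (hV : ∀ p, V p ≤ A.gr p),
    (∀ p < 1, V p = ⊥) ∧ Function.Bijective (lambdaMap A.toCGA V hV) ∧
    ∃ F : ℕ → ℤ → Submodule ℚ A, (∀ p, Monotone fun k => F k p) ∧ (∀ p, ⨆ k, F k p = V p) ∧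
      (∀ p, ∀ v ∈ F 0 p, A.d v = 0) ∧
      (∀ k p, ∀ v ∈ F (k + 1) p, A.d v ∈ Algebra.adjoin ℚ (⋃ q, (F k q : Set A)))

/-- A Sullivan model of `X`: a Sullivan algebra `(ΛV, d)` with a quasi-isomorphism
`(ΛV, d) → A_PL(X)`. -/
structure SullivanModel (X : Type u) [TopologicalSpace X] where
  algebra : CDGA.{v}
  isSullivanAlgebra : algebra.IsSullivanAlgebra
  map : CDGA.Hom algebra (apl X)
  isQuasiIso : map.IsQuasiIso

/-- `X` has the homotopy type of a CW complex of finite type. -/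
def HasFiniteTypeCWHomotopyType (X : Type u) [TopologicalSpace X] : Prop :=
  ∃ (Y : Type u) (_ : TopologicalSpace Y) (_ : T2Space Y)
    (_ : Topology.CWComplex (Set.univ : Set Y)),
    Topology.RelCWComplex.FiniteType (Set.univ : Set Y) ∧
      Nonempty (ContinuousMap.HomotopyEquiv X Y)

/-! ### The invariants `mtc` and `htc` -/

/-- The projection `p_n : A ⊗ A → (A ⊗ A) / (ker μ)^(n+1)`, as a morphism of differential modules
over `A ⊗ A`. -/
def projTC (A : CDGA.{u}) (n : ℕ) :
    DGModule.Hom (A.tensor A).self ((A.tensor A).self.quotient (A.mu.ker.pow (n + 1)).toSub) :=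
  DGModule.quotientMap _ _

namespace SullivanModel

variable {X : Type u} [TopologicalSpace X] (S : SullivanModel.{u, v} X)

/-- `mtc(X)`: the least `n` such that `p_n` admits a homotopy retraction as a morphism of
`(ΛV ⊗ ΛV, d)`-modules (`∞` if there is none). -/
def mtc : ℕ∞ := ⨅ (n : ℕ) (_ : (projTC S.algebra n).HasHomotopyRetraction), (n : ℕ∞)

/-- `htc(X)`: the least `n` such that `H(p_n)` is injective (`∞` if there is none). -/
def htc : ℕ∞ := ⨅ (n : ℕ) (_ : Function.Injective (projTC S.algebra n).H), (n : ℕ∞)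

end SullivanModel

end RHT

end

/-!
Let `B = A ⊗ A`. A Frobenius form on `H(A)` gives one on `H(B)` by the Künneth theorem. If a
morphism of differential `B`-modules `f : B → N` is injective in cohomology, the Frobenius form
`ε` of `H(B)` extends to a cocycle functional `ω` on `N`, and `n ↦ (a ↦ ω (a n))` is a morphism from
`N` to the graded dual of `B`. Its composite with `f` induces `c ↦ (x ↦ ε (x c))` in cohomology, so
it is a quasi-isomorphism by duality. Hence the homotopy pullback of `N → B^* ← B` is
quasi-isomorphic to `N`, and its projection onto `B` is a homotopy retraction of `f`.
-/

universe x

noncomputable section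

open scoped DirectSum TensorProduct

namespace RHT

/-! ### Graded vector spaces -/

section Graded

variable {M : Type u} [AddCommGroup M] [Module ℚ M] {G : ℤ → Submodule ℚ M}
  {N : Type v} [AddCommGroup N] [Module ℚ N] {G' : ℤ → Submodule ℚ N}

theorem exists_linearMap_eqOn (hG : DirectSum.IsInternal G) (f : ℤ → M →ₗ[ℚ] N) :
    ∃ F : M →ₗ[ℚ] N, ∀ p, ∀ x ∈ G p, F x = f p x := by
  let := hG.chooseDecomposition
  refine ⟨DirectSum.toModule ℚ ℤ N (fun p => f p ∘ₗ (G p).subtype) ∘ₗ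
    (DirectSum.decomposeLinearEquiv G).toLinearMap, fun p x hx => ?_⟩
  have h : DirectSum.decomposeLinearEquiv G x = DirectSum.lof ℚ ℤ (fun i => G i) p ⟨x, hx⟩ :=
    DirectSum.decompose_of_mem _ hx
  simp [h]

theorem isInternal_prod (hG : DirectSum.IsInternal G) (hG' : DirectSum.IsInternal G') :
    DirectSum.IsInternal fun p => (G p).prod (G' p) := by
  refine isInternal_of_proj _ (fun p => (proj hG p).prodMap (proj hG' p)) ?_ ?_ ?_
  · rintro p ⟨x, y⟩ ⟨hx, hy⟩
    exact Prod.ext (proj_of_mem hG hx) (proj_of_mem hG' hy)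
  · rintro p q hpq ⟨x, y⟩ ⟨hx, hy⟩
    exact Prod.ext (proj_of_mem_ne hG hpq hx) (proj_of_mem_ne hG' hpq hy)
  · simp_rw [LinearMap.prod_eq_sup_map, iSup_sup_eq, ← Submodule.map_iSup,
      hG.submodule_iSup_eq_top, hG'.submodule_iSup_eq_top, Submodule.map_top,
      LinearMap.sup_range_inl_inr]

/-- The linear map `L` is homogeneous of degree `k` for the gradings `G` and `G'`. -/
def HasDegree (G : ℤ → Submodule ℚ M) (G' : ℤ → Submodule ℚ N) (k : ℤ) (L : M →ₗ[ℚ] N) : Prop :=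
  ∀ ⦃p x⦄, x ∈ G p → L x ∈ G' (p + k)

theorem HasDegree.proj_apply {k : ℤ} {L : M →ₗ[ℚ] N} (hL : HasDegree G G' k L)
    (hG : DirectSum.IsInternal G) (hG' : DirectSum.IsInternal G') (p : ℤ) (x : M) :
    proj hG' (p + k) (L x) = L (proj hG p x) := by
  refine homogeneous_induction hG (f := proj hG' (p + k) ∘ₗ L) (g := L ∘ₗ proj hG p) ?_ x
  intro q y hy
  rcases eq_or_ne q p with rfl | hqp
  · simp [proj_of_mem hG hy, proj_of_mem hG' (hL hy)]
  · simp [proj_of_mem_ne hG hqp hy, proj_of_mem_ne hG' (show q + k ≠ p + k by lia) (hL hy)]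

/-- The functionals of degree `q` on a graded vector space: those that vanish on every component
other than the one of degree `q`. -/
def dualGr (G : ℤ → Submodule ℚ M) (q : ℤ) : Submodule ℚ (Module.Dual ℚ M) :=
  ⨅ (p : ℤ) (_ : p ≠ q), (G p).dualAnnihilator

theorem mem_dualGr {q : ℤ} {φ : Module.Dual ℚ M} :
    φ ∈ dualGr G q ↔ ∀ p, p ≠ q → ∀ x ∈ G p, φ x = 0 := by
  simp [dualGr, Submodule.mem_dualAnnihilator]

theorem comp_proj_mem_dualGr (hG : DirectSum.IsInternal G) (q : ℤ) (φ : Module.Dual ℚ M) :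
    φ ∘ₗ proj hG q ∈ dualGr G q :=
  mem_dualGr.2 fun p hp x hx => by simp [proj_of_mem_ne hG hp hx]

theorem apply_proj_of_mem_dualGr (hG : DirectSum.IsInternal G) {q : ℤ} {φ : Module.Dual ℚ M}
    (hφ : φ ∈ dualGr G q) (x : M) : φ (proj hG q x) = φ x := by
  refine homogeneous_induction hG (f := φ ∘ₗ proj hG q) (g := φ) ?_ x
  intro p y hy
  rcases eq_or_ne p q with rfl | hpq
  · simp [proj_of_mem hG hy]
  · simp [proj_of_mem_ne hG hpq hy, mem_dualGr.1 hφ p hpq y hy]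

theorem HasDegree.comp_mem_dualGr {k q : ℤ} {L : M →ₗ[ℚ] N} (hL : HasDegree G G' k L)
    {φ : Module.Dual ℚ N} (hφ : φ ∈ dualGr G' q) : φ ∘ₗ L ∈ dualGr G (q - k) :=
  mem_dualGr.2 fun p hp _ hx => mem_dualGr.1 hφ (p + k) (by lia) _ (hL hx)

/-- The graded dual of a graded vector space: the sums of homogeneous functionals. -/
def gradedDual (G : ℤ → Submodule ℚ M) : Submodule ℚ (Module.Dual ℚ M) :=
  ⨆ q, dualGr G q

theorem mem_gradedDual {q : ℤ} {φ : Module.Dual ℚ M} (hφ : φ ∈ dualGr G q) : φ ∈ gradedDual G :=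
  Submodule.mem_iSup_of_mem q hφ

theorem HasDegree.comp_mem_gradedDual {k : ℤ} {L : M →ₗ[ℚ] N} (hL : HasDegree G G' k L)
    {φ : Module.Dual ℚ N} (hφ : φ ∈ gradedDual G') : φ ∘ₗ L ∈ gradedDual G := by
  suffices gradedDual G' ≤ (gradedDual G).comap (LinearMap.lcomp ℚ ℚ L) from this hφ
  exact iSup_le fun q ψ hψ => mem_gradedDual (hL.comp_mem_dualGr hψ)

theorem isInternal_gradedDual (hG : DirectSum.IsInternal G) (m : ℤ) :
    DirectSum.IsInternal fun p => (dualGr G (m - p)).comap (gradedDual G).subtype := by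
  let π (p : ℤ) : gradedDual G →ₗ[ℚ] gradedDual G :=
    ((LinearMap.lcomp ℚ ℚ (proj hG (m - p))) ∘ₗ (gradedDual G).subtype).codRestrict _
      fun φ => mem_gradedDual (comp_proj_mem_dualGr hG _ φ.1)
  refine isInternal_of_proj _ π ?_ ?_ ?_
  · rintro p φ hφ
    exact Subtype.ext (LinearMap.ext (apply_proj_of_mem_dualGr hG hφ))
  · rintro p q hpq φ hφ
    refine Subtype.ext (LinearMap.ext fun x => ?_)
    exact mem_dualGr.1 hφ (m - p) (by lia) _ (proj_mem hG _ x)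
  · refine Submodule.map_injective_of_injective (gradedDual G).injective_subtype ?_
    simp only [Submodule.map_iSup, Submodule.map_comap_subtype, Submodule.map_top,
      Submodule.range_subtype]
    refine le_antisymm (iSup_le fun p => inf_le_left) (iSup_le fun q => ?_)
    refine le_iSup_of_le (m - q) (le_inf (le_iSup _ q) ?_)
    rw [sub_sub_cancel]

theorem exists_comp_comp_eq_self (f : M →ₗ[ℚ] N) :
    ∃ g : N →ₗ[ℚ] M, ∀ x, f (g (f x)) = f x := by
  obtain ⟨s, hs⟩ := f.rangeRestrict.exists_rightInverse_of_surjective f.range_rangeRestrict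
  obtain ⟨g, hg⟩ := s.exists_extend
  refine ⟨g, fun x => ?_⟩
  have hgs : g (f x) = s (f.rangeRestrict x) := LinearMap.congr_fun hg (f.rangeRestrict x)
  rw [hgs]
  exact congrArg Subtype.val (LinearMap.congr_fun hs (f.rangeRestrict x))

theorem exists_homotopy (hG : DirectSum.IsInternal G) {d : M →ₗ[ℚ] M} (hd : HasDegree G G 1 d)
    (hdd : ∀ x, d (d x) = 0) :
    ∃ σ π : M →ₗ[ℚ] M, HasDegree G G (-1) σ ∧ HasDegree G G 0 π ∧ (∀ x, d (π x) = 0) ∧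
      (∀ x, π (d x) = 0) ∧ ∀ x, x = π x + d (σ x) + σ (d x) := by
  obtain ⟨τ, hτ⟩ := exists_comp_comp_eq_self d
  obtain ⟨σ, hσ⟩ := exists_linearMap_eqOn hG fun p => proj hG (p + -1) ∘ₗ τ
  have hdσd (x : M) : d (σ (d x)) = d x := by
    refine homogeneous_induction hG (f := d ∘ₗ σ ∘ₗ d) (g := d) (fun p y hy => ?_) x
    calc d (σ (d y)) = d (proj hG p (τ (d y))) := by
          rw [hσ _ _ (hd hy), add_neg_cancel_right, LinearMap.comp_apply]
      _ = proj hG (p + 1) (d (τ (d y))) := (hd.proj_apply hG hG p _).symm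
      _ = d y := by rw [hτ, proj_of_mem hG (hd hy)]
  have hσ_deg : HasDegree G G (-1) σ := fun p x hx => by
    rw [hσ p x hx]
    exact proj_mem hG _ _
  refine ⟨σ, LinearMap.id - d ∘ₗ σ - σ ∘ₗ d, hσ_deg, fun p x hx => ?_, ?_, ?_, ?_⟩
  · have hdσ := hd (hσ_deg hx)
    have hσd := hσ_deg (hd hx)
    rw [neg_add_cancel_right] at hdσ
    rw [add_neg_cancel_right] at hσd
    rw [add_zero]
    exact Submodule.sub_mem _ (Submodule.sub_mem _ hx hdσ) hσd
  · simp [hdd, hdσd]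
  · simp [hdd, hdσd]
  · intro x
    simp only [LinearMap.sub_apply, LinearMap.id_apply, LinearMap.comp_apply]
    abel

end Graded

/-! ### Cohomology -/

namespace Cohomology

variable {M : Type u} [AddCommGroup M] [Module ℚ M] {d : M →ₗ[ℚ] M}
  {N : Type v} [AddCommGroup N] [Module ℚ N] {d' : N →ₗ[ℚ] N}

theorem cls_eq_cls_iff {z w : LinearMap.ker d} : cls d z = cls d w ↔ ∃ x, d x = z - w := by
  rw [← sub_eq_zero, ← map_sub, cls_eq_zero, Submodule.coe_sub]

theorem map_mem_ker {f : M →ₗ[ℚ] N} (hf : ∀ x, f (d x) = d' (f x)) (z : LinearMap.ker d) :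
    f z ∈ LinearMap.ker d' := by
  rw [LinearMap.mem_ker, ← hf, z.2, map_zero]

theorem map_injective_iff {f : M →ₗ[ℚ] N} (hf : ∀ x, f (d x) = d' (f x)) :
    Function.Injective (map f hf) ↔ ∀ z, d z = 0 → (∃ y, d' y = f z) → ∃ x, d x = z := by
  have hcls (z : LinearMap.ker d) :
      (map f hf (cls d z) = 0 → cls d z = 0) ↔ ((∃ y, d' y = f z) → ∃ x, d x = z) := by
    rw [map_cls f hf z (map_mem_ker hf z), cls_eq_zero, cls_eq_zero]
  rw [injective_iff_map_eq_zero, (cls_surjective d).forall]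
  simp_rw [hcls]
  exact Subtype.forall

theorem map_surjective_iff {f : M →ₗ[ℚ] N} (hf : ∀ x, f (d x) = d' (f x)) :
    Function.Surjective (map f hf) ↔ ∀ y, d' y = 0 → ∃ z, d z = 0 ∧ ∃ w, d' w = f z - y := by
  have hcls (y : LinearMap.ker d') (z : LinearMap.ker d) :
      map f hf (cls d z) = cls d' y ↔ ∃ w, d' w = f z - y := by
    rw [map_cls f hf z (map_mem_ker hf z), cls_eq_cls_iff]
  simp_rw [Function.Surjective, (cls_surjective d').forall, (cls_surjective d).exists, hcls]
  simp [Subtype.exists]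

variable {P : Type w} [AddCommGroup P] [Module ℚ P]

/-- The linear map on cohomology induced by a linear map that vanishes on coboundaries. -/
def lift (f : M →ₗ[ℚ] P) (hf : ∀ x, f (d x) = 0) : Cohomology d →ₗ[ℚ] P :=
  Submodule.liftQ _ (f ∘ₗ (LinearMap.ker d).subtype) (by
    rintro z ⟨x, hx⟩
    exact (congrArg f hx).symm.trans (hf x))

theorem lift_cls (f : M →ₗ[ℚ] P) (hf : ∀ x, f (d x) = 0) (z : LinearMap.ker d) :
    lift f hf (cls d z) = f z :=
  rfl

end Cohomology

/-! ### Differential modules -/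

namespace CDGA

variable (B : CDGA.{u})

theorem eps_one : B.eps 1 = 1 := by
  simpa using B.eps_of_mem (SetLike.GradedOne.one_mem : (1 : B) ∈ B.gr 0)

theorem hasDegree_eps : HasDegree B.gr B.gr 0 B.eps := fun p a ha => by
  rw [B.eps_of_mem ha, add_zero]
  exact Submodule.smul_mem _ _ ha

/-- The degree involution as a ring homomorphism. -/
def epsRingHom : B →+* B where
  toFun := B.eps
  map_one' := B.eps_one
  map_mul' := B.eps_mul
  map_zero' := map_zero _
  map_add' := map_add _

end CDGA

namespace DGModule

variable {B : CDGA.{u}}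

theorem d_smul (M : DGModule.{u, v} B) (a : B) (x : M) :
    M.d (a • x) = B.d a • x + B.eps a • M.d x := by
  refine homogeneous_induction B.internal
    (f := M.d ∘ₗ (Algebra.lsmul ℚ ℚ M).toLinearMap.flip x)
    (g := (Algebra.lsmul ℚ ℚ M).toLinearMap.flip x ∘ₗ B.d +
      (Algebra.lsmul ℚ ℚ M).toLinearMap.flip (M.d x) ∘ₗ B.eps) (fun p b hb => ?_) a
  simp [M.leibniz hb, B.eps_of_mem hb]

/-- The direct sum of two differential modules. -/
def prod (M : DGModule.{u, v} B) (N : DGModule.{u, w} B) : DGModule.{u, max v w} B where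
  carrier := M × N
  gr p := (M.gr p).prod (N.gr p)
  internal := isInternal_prod M.internal N.internal
  smul_mem ha hx := ⟨M.smul_mem ha hx.1, N.smul_mem ha hx.2⟩
  d := M.d.prodMap N.d
  d_mem hx := ⟨M.d_mem hx.1, N.d_mem hx.2⟩
  d_d x := Prod.ext (M.d_d x.1) (N.d_d x.2)
  leibniz ha x := Prod.ext (M.leibniz ha x.1) (N.leibniz ha x.2)

/-- The desuspension of a differential module: degrees go up by one, and both the differential and
the action of the elements of odd degree change sign. -/
def shift (M : DGModule.{u, v} B) : DGModule.{u, v} B where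
  carrier := M
  module := Module.compHom M B.epsRingHom
  tower := by
    have eps_smul (r : ℚ) (a : B) (x : M) : B.eps (r • a) • x = r • B.eps a • x := by
      rw [map_smul, smul_assoc]
    let := Module.compHom M B.epsRingHom
    exact ⟨eps_smul⟩
  gr p := M.gr (p - 1)
  internal := isInternal_of_proj _ (fun p => proj M.internal (p - 1))
    (fun _ _ hx => proj_of_mem M.internal hx)
    (fun _ _ hqp _ hx => proj_of_mem_ne M.internal (by simpa using hqp) hx)
    (((Equiv.subRight 1).iSup_comp (g := M.gr)).trans M.internal.submodule_iSup_eq_top)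
  smul_mem {p q a x} ha hx := by
    have h := M.smul_mem (B.hasDegree_eps ha) hx
    rwa [add_zero, ← add_sub_assoc] at h
  d := -M.d
  d_mem {p x} hx := by
    have h := M.d_mem hx
    rw [sub_add_eq_add_sub] at h
    exact Submodule.neg_mem _ h
  d_d x := by simp [M.d_d]
  leibniz {p a} ha x := by
    change -M.d (B.eps a • x) = B.eps (B.d a) • x + (-1 : ℚ) ^ p • B.eps a • -M.d x
    rw [M.d_smul, B.eps_eps, B.d_eps, B.eps_of_mem ha, smul_assoc, smul_neg, smul_smul,
      sgn_mul_self, one_smul, neg_smul]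
    abel

/-- The homotopy fiber of a morphism `k : M → E`: the differential module `M ⊕ E[-1]` with
`d (x, y) = (d x, k x - d y)`. -/
def Hom.fiber {M : DGModule.{u, v} B} {E : DGModule.{u, w} B} (k : Hom M E) :
    DGModule.{u, max v w} B where
  __ := M.prod E.shift
  d := (M.d ∘ₗ LinearMap.fst ℚ M E).prod
    (k.toLinearMap.restrictScalars ℚ ∘ₗ LinearMap.fst ℚ M E - E.d ∘ₗ LinearMap.snd ℚ M E)
  d_mem {p xy} hxy := by
    refine ⟨M.d_mem hxy.1, Submodule.sub_mem _ ?_ ?_⟩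
    · change k.toLinearMap xy.1 ∈ E.gr (p + 1 - 1)
      rw [add_sub_cancel_right]
      exact k.map_gr hxy.1
    · change E.d xy.2 ∈ E.gr (p + 1 - 1)
      rw [← sub_add_eq_add_sub]
      exact E.d_mem hxy.2
  d_d := by
    rintro ⟨x, (y : E)⟩
    refine Prod.ext (M.d_d x) ?_
    change k.toLinearMap (M.d x) - E.d (k.toLinearMap x - E.d y) = 0
    rw [k.map_d, map_sub, E.d_d, sub_zero, sub_self]
  leibniz := by
    rintro p a ha ⟨x, (y : E)⟩
    refine Prod.ext (M.leibniz ha x) ?_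
    change k.toLinearMap (a • x) - E.d (B.eps a • y) =
      B.eps (B.d a) • y + (-1 : ℚ) ^ p • B.eps a • (k.toLinearMap x - E.d y)
    rw [map_smul, E.d_smul, B.eps_eps, B.d_eps, B.eps_of_mem ha, smul_assoc, smul_smul,
      sgn_mul_self, one_smul, neg_smul, smul_sub]
    abel

namespace Hom

variable {M : DGModule.{u, v} B} {N : DGModule.{u, w} B} {E : DGModule.{u, x} B}

/-- The composition of morphisms of differential modules. -/
def comp (g : Hom N E) (f : Hom M N) : Hom M E where
  toLinearMap := g.toLinearMap ∘ₗ f.toLinearMap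
  map_gr hx := g.map_gr (f.map_gr hx)
  map_d x := (congrArg g.toLinearMap (f.map_d x)).trans (g.map_d _)

/-- The morphism `(x, y) ↦ g x - h y`. -/
def coprodSub (g : Hom N E) (h : Hom M E) : Hom (N.prod M) E where
  toLinearMap := g.toLinearMap ∘ₗ LinearMap.fst B N M - h.toLinearMap ∘ₗ LinearMap.snd B N M
  map_gr hx := Submodule.sub_mem _ (g.map_gr hx.1) (h.map_gr hx.2)
  map_d x := (congrArg₂ (· - ·) (g.map_d x.1) (h.map_d x.2)).trans (map_sub _ _ _).symm

/-- The homotopy pullback of two morphisms `g : N → E` and `h : M → E`. -/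
abbrev homotopyPullback (g : Hom N E) (h : Hom M E) : DGModule B :=
  (g.coprodSub h).fiber

/-- The projection of the homotopy pullback of `g : N → E` and `h : M → E` onto `N`. -/
def homotopyPullbackFst (g : Hom N E) (h : Hom M E) : Hom (g.homotopyPullback h) N where
  toLinearMap := LinearMap.fst B N M ∘ₗ LinearMap.fst B (N.prod M) E.shift
  map_gr hx := hx.1.1
  map_d _ := rfl

/-- The projection of the homotopy pullback of `g : N → E` and `h : M → E` onto `M`. -/
def homotopyPullbackSnd (g : Hom N E) (h : Hom M E) : Hom (g.homotopyPullback h) M where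
  toLinearMap := LinearMap.snd B N M ∘ₗ LinearMap.fst B (N.prod M) E.shift
  map_gr hx := hx.1.2
  map_d _ := rfl

theorem injective_H_iff {f : Hom M N} :
    Function.Injective f.H ↔
      ∀ z, M.d z = 0 → (∃ y, N.d y = f.toLinearMap z) → ∃ x, M.d x = z :=
  Cohomology.map_injective_iff f.map_d

theorem surjective_H_iff {f : Hom M N} :
    Function.Surjective f.H ↔
      ∀ y, N.d y = 0 → ∃ z, M.d z = 0 ∧ ∃ w, N.d w = f.toLinearMap z - y :=
  Cohomology.map_surjective_iff f.map_d

theorem isQuasiIso_homotopyPullbackFst (g : Hom N E) {h : Hom M E} (hh : h.IsQuasiIso) :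
    (g.homotopyPullbackFst h).IsQuasiIso := by
  have hsurj := surjective_H_iff.1 hh.2
  refine ⟨injective_H_iff.2 ?_, surjective_H_iff.2 fun n hn => ?_⟩
  · rintro ⟨⟨_, m⟩, (y : E)⟩ hz ⟨n, rfl⟩
    have hm : M.d m = 0 := congrArg (fun t => t.1.2) hz
    have hy : g.toLinearMap (N.d n) - h.toLinearMap m - E.d y = 0 := congrArg Prod.snd hz
    obtain ⟨m', rfl⟩ := injective_H_iff.1 hh.1 m hm ⟨g.toLinearMap n - y, by
      rw [map_sub, ← g.map_d, ← sub_eq_zero, ← hy]; abel⟩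
    obtain ⟨c, hc, η, hη⟩ := hsurj (g.toLinearMap n - h.toLinearMap m' - y) (by
      rw [map_sub, map_sub, ← g.map_d, ← h.map_d, hy])
    refine ⟨((n, m' + c), -η), Prod.ext (Prod.ext rfl ?_) ?_⟩
    · change M.d (m' + c) = M.d m'
      rw [map_add, hc, add_zero]
    · change g.toLinearMap n - h.toLinearMap (m' + c) - E.d (-η) = y
      rw [map_neg, hη, map_add]
      abel
  · obtain ⟨c, hc, η, hη⟩ := hsurj (g.toLinearMap n) (by rw [← g.map_d, hn, map_zero])
    refine ⟨((n, c), -η), Prod.ext (Prod.ext hn hc) ?_, 0, ?_⟩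
    · change g.toLinearMap n - h.toLinearMap c - E.d (-η) = 0
      rw [map_neg, hη]
      abel
    · change N.d 0 = n - n
      rw [map_zero, sub_self]

end Hom

namespace Hom

variable {M N E : DGModule.{u, u} B}

theorem hasHomotopyRetraction_of_isQuasiIso_comp {f : Hom M N} {g : Hom N E}
    (hgf : (g.comp f).IsQuasiIso) : f.HasHomotopyRetraction := by
  let j : Hom M (g.homotopyPullback (g.comp f)) :=
    { toLinearMap := (f.toLinearMap.prod LinearMap.id).prod (0 : M →ₗ[B] E.shift)
      map_gr := fun hx => ⟨⟨f.map_gr hx, hx⟩, Submodule.zero_mem _⟩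
      map_d := fun x => Prod.ext (Prod.ext (f.map_d x) rfl) <| by
        change 0 = g.toLinearMap (f.toLinearMap x) - g.toLinearMap (f.toLinearMap x) - E.d 0
        rw [sub_self, map_zero, sub_zero] }
  exact ⟨_, j, g.homotopyPullbackFst _, g.homotopyPullbackSnd _,
    g.isQuasiIso_homotopyPullbackFst hgf, fun _ => rfl, fun _ => rfl⟩

theorem HasHomotopyRetraction.injective_H {f : Hom M N} (hf : f.HasHomotopyRetraction) :
    Function.Injective f.H := by
  obtain ⟨P, j, ψ, ρ, hψ, hψj, hρj⟩ := hf
  refine injective_H_iff.2 fun z hz ⟨y, hy⟩ => ?_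
  have hjz : P.d (j.toLinearMap z) = 0 := by rw [← j.map_d, hz, map_zero]
  obtain ⟨x, hx⟩ := injective_H_iff.1 hψ.1 (j.toLinearMap z) hjz ⟨y, by rw [hy, hψj]⟩
  exact ⟨ρ.toLinearMap x, by rw [← ρ.map_d, hx, hρj]⟩

end Hom

end DGModule

/-! ### The graded dual as a differential module -/

namespace DGModule

variable {B : CDGA.{u}} (N : DGModule.{u, v} B)

/-- The linear map `a ↦ a • n`, as a linear function of `n`. -/
def orbit : N →ₗ[ℚ] B →ₗ[ℚ] N :=
  (Algebra.lsmul ℚ ℚ N).toLinearMap.flip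

variable {N}

theorem hasDegree_orbit {q : ℤ} {n : N} (hn : n ∈ N.gr q) :
    HasDegree B.gr N.gr q (N.orbit n) :=
  fun _ _ ha => N.smul_mem ha hn

theorem comp_orbit_mem_gradedDual {φ : Module.Dual ℚ N} (hφ : φ ∈ gradedDual N.gr) (n : N) :
    φ ∘ₗ N.orbit n ∈ gradedDual B.gr := by
  let S : Submodule ℚ N := (gradedDual B.gr).comap (LinearMap.llcomp ℚ B N ℚ φ ∘ₗ N.orbit)
  suffices ⊤ ≤ S from this Submodule.mem_top
  rw [← N.internal.submodule_iSup_eq_top]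
  exact iSup_le fun q x hx => (hasDegree_orbit hx).comp_mem_gradedDual hφ

end DGModule

namespace CDGA

variable (B : CDGA.{u})

theorem hasDegree_d : HasDegree B.gr B.gr 1 B.d := fun _ _ => B.d_mem

instance : SMul B (gradedDual B.gr) where
  smul a φ := ⟨φ.1 ∘ₗ B.self.orbit a, B.self.comp_orbit_mem_gradedDual φ.2 a⟩

theorem smul_dual_apply (a : B) (φ : gradedDual B.gr) (x : B) : (a • φ).1 x = φ.1 (x * a) := rfl

instance : Module B (gradedDual B.gr) where
  one_smul φ := Subtype.ext <| LinearMap.ext fun x => by rw [smul_dual_apply, mul_one]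
  mul_smul a b φ := Subtype.ext <| LinearMap.ext fun x => by
    simp only [smul_dual_apply, mul_assoc]
  smul_zero _ := rfl
  smul_add _ _ _ := rfl
  add_smul a b φ := Subtype.ext <| LinearMap.ext fun x => by
    simp only [smul_dual_apply, mul_add, map_add, Submodule.coe_add, LinearMap.add_apply]
  zero_smul φ := Subtype.ext <| LinearMap.ext fun x => by
    simp only [smul_dual_apply, mul_zero, map_zero, Submodule.coe_zero, LinearMap.zero_apply]

theorem hasDegree_eps_comp_d : HasDegree B.gr B.gr 1 (B.eps ∘ₗ B.d) := fun p x hx => by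
  have h := B.hasDegree_eps (B.d_mem hx)
  rwa [add_zero] at h

/-- The differential `φ ↦ φ ∘ ε ∘ d` of the graded dual, where `ε` is the degree involution. -/
def dualD : gradedDual B.gr →ₗ[ℚ] gradedDual B.gr :=
  (LinearMap.lcomp ℚ ℚ (B.eps ∘ₗ B.d)).restrict fun _ => B.hasDegree_eps_comp_d.comp_mem_gradedDual

theorem dualD_apply (φ : gradedDual B.gr) (x : B) : (B.dualD φ).1 x = φ.1 (B.eps (B.d x)) := rfl

/-- The graded dual of `B`, with `(a • φ) x = φ (x a)`, regraded so that the functionals of degree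
`m` have degree `0`. -/
def dual (m : ℤ) : DGModule.{u, u} B where
  carrier := gradedDual B.gr
  tower := ⟨fun r a φ => Subtype.ext <| LinearMap.ext fun x => by
    rw [smul_dual_apply, mul_smul_comm, map_smul]; rfl⟩
  gr p := (dualGr B.gr (m - p)).comap (gradedDual B.gr).subtype
  internal := isInternal_gradedDual B.internal m
  smul_mem {p q a φ} ha hφ := by
    have h := (B.self.hasDegree_orbit ha).comp_mem_dualGr hφ
    rwa [sub_sub, add_comm q p] at h
  d := B.dualD
  d_mem {p φ} hφ := by
    have h := B.hasDegree_eps_comp_d.comp_mem_dualGr hφ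
    rwa [sub_sub] at h
  d_d φ := Subtype.ext <| LinearMap.ext fun x => by
    simp only [dualD_apply, d_eps, B.d_d, map_zero, neg_zero, Submodule.coe_zero,
      LinearMap.zero_apply]
  leibniz {p a} ha φ := Subtype.ext <| LinearMap.ext fun x => by
    have hd : B.eps (B.d (x * a)) =
        (-1 : ℚ) ^ p • (B.eps (B.d x) * a) - (-1 : ℚ) ^ p • (x * B.d a) := by
      rw [d_mul, map_add, eps_mul, eps_mul, eps_eps, B.eps_of_mem ha, B.eps_of_mem (B.d_mem ha),
        mul_smul_comm, mul_smul_comm, zpow_add₀ (by norm_num), zpow_one, mul_neg_one, neg_smul,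
        sub_eq_add_neg]
    change φ.1 (B.eps (B.d x) * a) = φ.1 (x * B.d a) + (-1 : ℚ) ^ p * φ.1 (B.eps (B.d (x * a)))
    rw [hd, map_sub, map_smul, map_smul, smul_eq_mul, smul_eq_mul]
    linear_combination (φ.1 (x * B.d a) - φ.1 (B.eps (B.d x) * a)) * sgn_mul_self p

theorem exists_dualD_eq {φ : gradedDual B.gr} (hφ : ∀ z, B.d z = 0 → φ.1 z = 0) :
    ∃ η, B.dualD η = φ := by
  obtain ⟨σ, π, hσ, -, hdπ, -, hσπ⟩ := exists_homotopy B.internal B.hasDegree_d B.d_d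
  refine ⟨⟨(φ.1 ∘ₗ σ) ∘ₗ B.eps, B.hasDegree_eps.comp_mem_gradedDual
    (hσ.comp_mem_gradedDual φ.2)⟩, Subtype.ext <| LinearMap.ext fun x => ?_⟩
  calc φ.1 (σ (B.eps (B.eps (B.d x)))) = φ.1 (π x) + φ.1 (B.d (σ x)) + φ.1 (σ (B.d x)) := by
        rw [hφ _ (hdπ x), hφ _ (B.d_d _), eps_eps, zero_add, zero_add]
    _ = φ.1 x := by rw [← map_add, ← map_add, ← hσπ]

theorem apply_d_of_dualD_eq_zero {φ : gradedDual B.gr} (hφ : B.dualD φ = 0) (x : B) :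
    φ.1 (B.d x) = 0 := by
  have h : φ.1 (B.eps (B.d (B.eps x))) = 0 := LinearMap.congr_fun (congrArg Subtype.val hφ) _
  rwa [d_eps, map_neg, eps_eps, map_neg, neg_eq_zero] at h

end CDGA

/-- The morphism `n ↦ (a ↦ ω (a • n))` into the graded dual, for a functional `ω` of degree `m`
that vanishes on coboundaries. -/
def DGModule.toDual {B : CDGA.{u}} (N : DGModule.{u, v} B) {m : ℤ} {ω : Module.Dual ℚ N}
    (hω : ω ∈ dualGr N.gr m) (hωd : ∀ n, ω (N.d n) = 0) : Hom N (B.dual m) where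
  toLinearMap :=
    { toFun := fun n => ⟨ω ∘ₗ N.orbit n, comp_orbit_mem_gradedDual (mem_gradedDual hω) n⟩
      map_add' := fun n n' => Subtype.ext <| LinearMap.ext fun x =>
        (congrArg ω (smul_add x n n')).trans (map_add ω _ _)
      map_smul' := fun a n => Subtype.ext <| LinearMap.ext fun x =>
        congrArg ω (mul_smul x a n).symm }
  map_gr hn := (hasDegree_orbit hn).comp_mem_dualGr hω
  map_d n := Subtype.ext <| LinearMap.ext fun x => by
    change ω (x • N.d n) = ω (B.eps (B.d x) • n)
    have h := hωd (B.eps x • n)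
    rw [N.d_smul, B.d_eps, B.eps_eps, neg_smul, map_add, map_neg, neg_add_eq_zero] at h
    exact h.symm

/-! ### Frobenius forms -/

namespace CGA

/-- The linear map `c ↦ (x ↦ ε (x c))` defined by a functional `ε` on an algebra. -/
def pairing (H : CGA.{u}) (ε : Module.Dual ℚ H) : H →ₗ[ℚ] Module.Dual ℚ H :=
  (LinearMap.mul ℚ H).flip.compr₂ ε

/-- `ε` is a Frobenius form of degree `m` on the finite dimensional algebra `H`: a functional of
degree `m` such that every functional on `H` has the form `x ↦ ε (x c)`. -/
structure IsFrobeniusForm (H : CGA.{u}) (m : ℤ) (ε : Module.Dual ℚ H) : Prop where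
  finiteDimensional : FiniteDimensional ℚ H
  mem_dualGr : ε ∈ dualGr H.gr m
  surjective : Function.Surjective (H.pairing ε)

variable {H : CGA.{u}} {H' : CGA.{v}} {m : ℤ}

theorem injective_pairing_iff_surjective [FiniteDimensional ℚ H] {ε : Module.Dual ℚ H} :
    Function.Injective (H.pairing ε) ↔ Function.Surjective (H.pairing ε) :=
  LinearMap.injective_iff_surjective_of_finrank_eq_finrank Subspace.dual_finrank_eq.symm

theorem IsFrobeniusForm.injective {ε : Module.Dual ℚ H} (hε : H.IsFrobeniusForm m ε) :
    Function.Injective (H.pairing ε) :=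
  have := hε.finiteDimensional
  injective_pairing_iff_surjective.2 hε.surjective

theorem IsPoincareDualityAlgebra.exists_isFrobeniusForm (hH : H.IsPoincareDualityAlgebra) :
    ∃ m ε, H.IsFrobeniusForm m ε := by
  obtain ⟨hfin, -, -, n, -, -, -, -, ε, -, hε, -, hsurj⟩ := hH
  refine ⟨n, ε, hfin, mem_dualGr.2 hε, injective_pairing_iff_surjective.1 ?_⟩
  refine (injective_iff_map_eq_zero _).2 fun c hc =>
    (Module.forall_dual_apply_eq_zero_iff ℚ c).1 fun ψ => ?_
  obtain ⟨x, rfl⟩ := hsurj ψ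
  exact LinearMap.congr_fun hc x

theorem IsFrobeniusForm.comp_algEquiv {ε : Module.Dual ℚ H'} (hε : H'.IsFrobeniusForm m ε)
    (e : H ≃ₐ[ℚ] H') (he : HasDegree H.gr H'.gr 0 e.toLinearMap) :
    H.IsFrobeniusForm m (ε ∘ₗ e.toLinearMap) where
  finiteDimensional :=
    have := hε.finiteDimensional
    e.symm.toLinearEquiv.finiteDimensional
  mem_dualGr := by simpa using he.comp_mem_dualGr hε.mem_dualGr
  surjective ψ := by
    obtain ⟨c, hc⟩ := hε.surjective (ψ ∘ₗ e.symm.toLinearMap)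
    refine ⟨e.symm c, LinearMap.ext fun x => ?_⟩
    simpa [pairing] using LinearMap.congr_fun hc (e x)

end CGA

namespace CDGA

variable {A : CDGA.{u}} {C : CDGA.{v}}

/-- The algebra homomorphism `H(f)` induced in cohomology. -/
def Hom.cohomologyMap (f : Hom A C) : A.cohomology →ₐ[ℚ] C.cohomology :=
  AlgHom.ofLinearMap (Cohomology.map (d := A.d) (d' := C.d) f.toAlgHom.toLinearMap f.map_d)
    (congrArg (Cohomology.cls C.d) (Subtype.ext (map_one f.toAlgHom)))
    (by
      intro x y
      obtain ⟨z, rfl⟩ := Cohomology.cls_surjective _ x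
      obtain ⟨w, rfl⟩ := Cohomology.cls_surjective _ y
      exact congrArg (Cohomology.cls C.d) (Subtype.ext (map_mul f.toAlgHom z.1 w.1)))

theorem Hom.hasDegree_cohomologyMap (f : Hom A C) :
    HasDegree A.grH C.grH 0 f.cohomologyMap.toLinearMap := by
  rintro p _ ⟨z, hz, rfl⟩
  rw [add_zero]
  exact ⟨⟨f.toAlgHom z, Cohomology.map_mem_ker (f := f.toAlgHom.toLinearMap) f.map_d z⟩,
    f.map_gr hz, rfl⟩

theorem Hom.IsQuasiIso.isFrobeniusForm {f : Hom A C} (hf : f.IsQuasiIso) {m : ℤ}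
    {ε : Module.Dual ℚ C.cohomology} (hε : C.cohomology.IsFrobeniusForm m ε) :
    A.cohomology.IsFrobeniusForm m (ε ∘ₗ f.cohomologyMap.toLinearMap) :=
  hε.comp_algEquiv (AlgEquiv.ofBijective f.cohomologyMap hf) f.hasDegree_cohomologyMap

variable (A) in
theorem exists_cocycleClass : ∃ R : A →ₗ[ℚ] A.H, HasDegree A.gr A.grH 0 R ∧
    ∀ z : LinearMap.ker A.d, R z = Cohomology.cls A.d z := by
  obtain ⟨σ, π, -, hπ, hdπ, -, hσπ⟩ := exists_homotopy A.internal A.hasDegree_d A.d_d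
  refine ⟨Cohomology.cls A.d ∘ₗ π.codRestrict (LinearMap.ker A.d) hdπ,
    fun p x hx => ⟨_, hπ hx, rfl⟩, fun z => Cohomology.cls_eq_cls_iff.2 ⟨-σ z, ?_⟩⟩
  have hz : (z : A) = π z + A.d (σ z) := by simpa [LinearMap.mem_ker.1 z.2] using hσπ z
  rw [map_neg, neg_eq_iff_add_eq_zero]
  change A.d (σ z) + (π z - z) = 0
  rw [← add_sub_assoc, add_comm, ← hz, sub_self]

end CDGA

namespace DGModule

variable {B : CDGA.{u}} {m : ℤ} {ε : Module.Dual ℚ B.cohomology}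

theorem Hom.isQuasiIso_of_isFrobeniusForm (hε : B.cohomology.IsFrobeniusForm m ε) {k : ℤ}
    {g : Hom B.self (B.dual k)} (hg : ∀ z w : LinearMap.ker B.d, (g.toLinearMap z.1).1 w =
      ε (Cohomology.cls B.d w * Cohomology.cls B.d z)) : g.IsQuasiIso := by
  refine ⟨injective_H_iff.2 ?_, surjective_H_iff.2 ?_⟩
  · rintro z hz ⟨η, hη⟩
    refine (Cohomology.cls_eq_zero (d := B.d) ⟨z, hz⟩).1 (hε.injective (LinearMap.ext fun c => ?_))
    obtain ⟨w, rfl⟩ := Cohomology.cls_surjective B.d c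
    calc ε (Cohomology.cls B.d w * Cohomology.cls B.d ⟨z, hz⟩) = (g.toLinearMap z).1 w :=
          (hg ⟨z, hz⟩ w).symm
      _ = η.1 (B.eps (B.d w)) := by rw [← hη]; rfl
      _ = 0 := by rw [w.2, map_zero, map_zero]
      _ = B.cohomology.pairing ε 0 (Cohomology.cls B.d w) := by rw [map_zero]; rfl
  · intro φ hφ
    obtain ⟨c, hc⟩ := hε.surjective (Cohomology.lift φ.1 (B.apply_d_of_dualD_eq_zero hφ))
    obtain ⟨z, rfl⟩ := Cohomology.cls_surjective B.d c
    refine ⟨z.1, z.2, B.exists_dualD_eq fun w hw => sub_eq_zero.2 ?_⟩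
    exact (hg z ⟨w, hw⟩).trans (LinearMap.congr_fun hc (Cohomology.cls B.d ⟨w, hw⟩))

theorem Hom.exists_cocycle_extension (hε : ε ∈ dualGr B.grH m) {N : DGModule.{u, v} B}
    {f : Hom B.self N} (hf : Function.Injective f.H) :
    ∃ ω ∈ dualGr N.gr m, (∀ n, ω (N.d n) = 0) ∧
      ∀ z : LinearMap.ker B.d, ω (f.toLinearMap z.1) = ε (Cohomology.cls B.d z) := by
  have hNd : HasDegree N.gr N.gr 1 N.d := fun _ _ => N.d_mem
  have hf₀ : HasDegree B.gr N.gr 0 (f.toLinearMap.restrictScalars ℚ) := fun p a ha =>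
    (add_zero p).symm ▸ f.map_gr ha
  obtain ⟨ε', hε'⟩ := LinearMap.dualMap_surjective_of_injective hf ε
  obtain ⟨R, hR⟩ := (Cohomology.cls N.d).exists_extend
  obtain ⟨r, hr_deg, hr⟩ := B.exists_cocycleClass
  have hεr : ε ∘ₗ r ∈ dualGr B.gr m := sub_zero m ▸ hr_deg.comp_mem_dualGr hε
  have hR_ker (z : LinearMap.ker N.d) : R z = Cohomology.cls N.d z := LinearMap.congr_fun hR z
  refine ⟨(ε' ∘ₗ R) ∘ₗ proj N.internal m, comp_proj_mem_dualGr _ _ _, fun n => ?_, fun z => ?_⟩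
  · have hproj : proj N.internal m (N.d n) = N.d (proj N.internal (m - 1) n) := by
      simpa using hNd.proj_apply N.internal N.internal (m - 1) n
    have hcls := hR_ker ⟨N.d (proj N.internal (m - 1) n), N.d_d _⟩
    rw [(Cohomology.cls_eq_zero _).2 ⟨_, rfl⟩] at hcls
    simp [hproj, hcls]
  · have hz : B.d (proj B.internal m z) = 0 := by
      rw [← B.proj_d, z.2, map_zero]
    have hproj := hf₀.proj_apply B.internal N.internal m z.1
    rw [add_zero] at hproj
    calc ε' (R (proj N.internal m (f.toLinearMap z.1)))
        = ε' (R (f.toLinearMap (proj B.internal m z.1))) := congrArg (ε' ∘ₗ R) hproj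
      _ = ε' (f.H (Cohomology.cls B.d ⟨proj B.internal m z, hz⟩)) :=
          congrArg ε' (hR_ker ⟨_, Cohomology.map_mem_ker (d := B.d)
            (f := f.toLinearMap.restrictScalars ℚ) f.map_d ⟨_, hz⟩⟩)
      _ = ε (r (proj B.internal m z)) :=
          (LinearMap.congr_fun hε' _).trans (congrArg ε (hr ⟨_, hz⟩).symm)
      _ = ε (Cohomology.cls B.d z) :=
          (apply_proj_of_mem_dualGr B.internal hεr _).trans (congrArg ε (hr z))

theorem Hom.hasHomotopyRetraction_iff (hε : B.cohomology.IsFrobeniusForm m ε)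
    {N : DGModule.{u, u} B} {f : Hom B.self N} :
    f.HasHomotopyRetraction ↔ Function.Injective f.H := by
  refine ⟨Hom.HasHomotopyRetraction.injective_H, fun hf => ?_⟩
  obtain ⟨ω, hω, hωd, hωf⟩ := Hom.exists_cocycle_extension hε.mem_dualGr hf
  refine hasHomotopyRetraction_of_isQuasiIso_comp (g := N.toDual hω hωd)
    (isQuasiIso_of_isFrobeniusForm hε fun z w => ?_)
  exact (congrArg ω (map_smul f.toLinearMap w.1 z.1).symm).trans (hωf (B.mulZ w z))

end DGModule

/-! ### The Künneth theorem -/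

namespace CDGA

theorem apply_eps_of_hasDegree {A : CDGA.{u}} {k : ℤ} {L : A →ₗ[ℚ] A}
    (hL : HasDegree A.gr A.gr k L) (a : A) : L (A.eps a) = (-1 : ℚ) ^ k • A.eps (L a) := by
  refine homogeneous_induction A.internal (f := L ∘ₗ A.eps) (g := (-1 : ℚ) ^ k • A.eps ∘ₗ L)
    (fun p b hb => ?_) a
  simp only [LinearMap.comp_apply, LinearMap.smul_apply, A.eps_of_mem hb, A.eps_of_mem (hL hb),
    map_smul, smul_smul, zpow_add₀ (show (-1 : ℚ) ≠ 0 by norm_num)]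
  congr 1
  linear_combination (-(-1 : ℚ) ^ p) * sgn_mul_self k

variable {A : CDGA.{u}} {B : CDGA.{v}}

theorem exists_tensor_homotopy {σ π : A →ₗ[ℚ] A} {σ' π' : B →ₗ[ℚ] B}
    (hσ : HasDegree A.gr A.gr (-1) σ) (hπ : HasDegree A.gr A.gr 0 π)
    (hdπ : ∀ a, A.d (π a) = 0) (hπd : ∀ a, π (A.d a) = 0)
    (hA : ∀ a, a = π a + A.d (σ a) + σ (A.d a)) (hB : ∀ b, b = π' b + B.d (σ' b) + σ' (B.d b)) :
    ∃ K : TensorCarrier A B →ₗ[ℚ] TensorCarrier A B, ∀ x, x =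
      tensorLift A B ((tmk A B).compl₁₂ π π') x + tensorD A B (K x) + K (tensorD A B x) := by
  let K := tensorLift A B
    ((tmk A B).compl₁₂ σ LinearMap.id + (tmk A B).compl₁₂ (A.eps ∘ₗ π) σ')
  have hK (a : A) (b : B) :
      K (tmk A B a b) = tmk A B (σ a) b + tmk A B (A.eps (π a)) (σ' b) := by
    simp [K, tensorLift_tmk]
  refine ⟨K, tensor_induction A B (f := LinearMap.id) (g := tensorLift A B
    ((tmk A B).compl₁₂ π π') + tensorD A B ∘ₗ K + K ∘ₗ tensorD A B) fun p q a _ b _ => ?_⟩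
  have hσε : σ (A.eps a) = -A.eps (σ a) := by simpa using apply_eps_of_hasDegree hσ a
  have hπε : π (A.eps a) = A.eps (π a) := by simpa using apply_eps_of_hasDegree hπ a
  have hdεπ : A.d (A.eps (π a)) = 0 := by rw [d_eps, hdπ, map_zero, neg_zero]
  have ha : tmk A B a b = tmk A B (π a) b + tmk A B (A.d (σ a)) b + tmk A B (σ (A.d a)) b := by
    rw [← LinearMap.map_add₂, ← LinearMap.map_add₂, ← hA]
  have hb : tmk A B (π a) b = tmk A B (π a) (π' b) + tmk A B (π a) (B.d (σ' b)) +
      tmk A B (π a) (σ' (B.d b)) := by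
    rw [← map_add, ← map_add, ← hB]
  simp only [LinearMap.id_apply, LinearMap.add_apply, LinearMap.comp_apply, hK, map_add,
    tensorD_tmk, tensorLift_tmk, LinearMap.compl₁₂_apply, hσε, hπε, hdεπ, hπd, eps_eps, map_zero,
    map_neg, LinearMap.zero_apply, LinearMap.neg_apply]
  rw [ha, hb]
  abel

/-- The cocycle `z ⊗ w` of `A ⊗ B` defined by cocycles `z` of `A` and `w` of `B`. -/
def tensorCocycle (z : LinearMap.ker A.d) (w : LinearMap.ker B.d) :
    LinearMap.ker (A.tensor B).d :=
  ⟨tmk A B z w, by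
    change tensorD A B (tmk A B z w) = 0
    simp only [tensorD_tmk, LinearMap.mem_ker.1 z.2, LinearMap.mem_ker.1 w.2, map_zero,
      LinearMap.zero_apply, add_zero]⟩

theorem exists_tensor_cocycleClass (A : CDGA.{u}) (B : CDGA.{v}) :
    ∃ ρ : TensorCarrier A B →ₗ[ℚ] A.H ⊗[ℚ] B.H, (∀ x, ρ (tensorD A B x) = 0) ∧
      ∀ (z : LinearMap.ker A.d) (w : LinearMap.ker B.d),
        ρ (tmk A B z w) = Cohomology.cls A.d z ⊗ₜ Cohomology.cls B.d w := by
  obtain ⟨R, -, hR⟩ := A.exists_cocycleClass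
  obtain ⟨R', -, hR'⟩ := B.exists_cocycleClass
  have hRd (a : A) : R (A.d a) = 0 :=
    (hR ⟨A.d a, A.d_d a⟩).trans ((Cohomology.cls_eq_zero _).2 ⟨a, rfl⟩)
  have hRd' (b : B) : R' (B.d b) = 0 :=
    (hR' ⟨B.d b, B.d_d b⟩).trans ((Cohomology.cls_eq_zero _).2 ⟨b, rfl⟩)
  refine ⟨tensorLift A B ((TensorProduct.mk ℚ A.H B.H).compl₁₂ R R'), ?_, fun z w => ?_⟩
  · refine tensor_induction A B (f := tensorLift A B _ ∘ₗ tensorD A B) (g := 0)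
      fun p q a _ b _ => ?_
    simp [tensorD_tmk, tensorLift_tmk, hRd, hRd']
  · simp [tensorLift_tmk, hR, hR']

theorem exists_tensorD_eq {ρ : TensorCarrier A B →ₗ[ℚ] A.H ⊗[ℚ] B.H}
    (hρd : ∀ x, ρ (tensorD A B x) = 0)
    (hρ : ∀ (z : LinearMap.ker A.d) (w : LinearMap.ker B.d),
      ρ (tmk A B z w) = Cohomology.cls A.d z ⊗ₜ Cohomology.cls B.d w)
    {x : TensorCarrier A B} (hx : tensorD A B x = 0) (hρx : ρ x = 0) :
    ∃ y, tensorD A B y = x := by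
  obtain ⟨σ, π, hσ, hπ, hdπ, hπd, hA⟩ := exists_homotopy A.internal A.hasDegree_d A.d_d
  obtain ⟨σ', π', -, -, hdπ', hπd', hB⟩ := exists_homotopy B.internal B.hasDegree_d B.d_d
  obtain ⟨K, hK⟩ := exists_tensor_homotopy hσ hπ hdπ hπd hA hB
  let Q := tensorLift A B ((tmk A B).compl₁₂ π π')
  let S := TensorProduct.lift
    ((tmk A B).compl₁₂ (Cohomology.lift π hπd) (Cohomology.lift π' hπd'))
  have hQQ (y : TensorCarrier A B) : Q (Q y) = S (ρ (Q y)) := by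
    refine tensor_induction A B (f := Q ∘ₗ Q) (g := S ∘ₗ ρ ∘ₗ Q) (fun p q a _ b _ => ?_) y
    have hρπ := hρ ⟨π a, hdπ a⟩ ⟨π' b, hdπ' b⟩
    simp [Q, S, tensorLift_tmk, hρπ, Cohomology.lift_cls]
  have hxQ : x = Q x + tensorD A B (K x) := by simpa [hx] using hK x
  have hQx : tensorD A B (Q x) = 0 := by
    refine tensor_induction A B (f := tensorD A B ∘ₗ Q) (g := 0) (fun p q a _ b _ => ?_) x
    simp [Q, tensorLift_tmk, tensorD_tmk, hdπ, hdπ']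
  have hρQ : ρ (Q x) = 0 := by
    have h := congrArg ρ hxQ
    rw [map_add, hρd, hρx, add_zero] at h
    exact h.symm
  have hQ : Q x = tensorD A B (K (Q x)) := by
    have h := hK (Q x)
    rwa [hQx, map_zero, add_zero, show tensorLift A B _ (Q x) = _ from hQQ x, hρQ, map_zero,
      zero_add] at h
  exact ⟨K (Q x) + K x, by rw [map_add, ← hQ, ← hxQ]⟩

theorem exists_kunnethEquiv (A : CDGA.{u}) (B : CDGA.{v}) :
    ∃ κ : (A.tensor B).H ≃ₗ[ℚ] A.H ⊗[ℚ] B.H, ∀ z w,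
      κ (Cohomology.cls _ (tensorCocycle z w)) = Cohomology.cls A.d z ⊗ₜ Cohomology.cls B.d w := by
  obtain ⟨ρ, hρd, hρ⟩ := exists_tensor_cocycleClass A B
  let κ : (A.tensor B).H →ₗ[ℚ] A.H ⊗[ℚ] B.H := Cohomology.lift ρ hρd
  have hinj : Function.Injective κ := by
    refine (injective_iff_map_eq_zero κ).2 fun c hc => ?_
    obtain ⟨x, rfl⟩ := Cohomology.cls_surjective _ c
    exact (Cohomology.cls_eq_zero x).2 (exists_tensorD_eq hρd hρ x.2 hc)
  have hsurj : Function.Surjective κ := by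
    refine LinearMap.range_eq_top.1 (top_le_iff.1 ?_)
    rw [← TensorProduct.span_tmul_eq_top, Submodule.span_le]
    rintro _ ⟨x, y, rfl⟩
    obtain ⟨z, rfl⟩ := Cohomology.cls_surjective _ x
    obtain ⟨w, rfl⟩ := Cohomology.cls_surjective _ y
    exact ⟨Cohomology.cls _ (tensorCocycle z w), hρ z w⟩
  exact ⟨LinearEquiv.ofBijective κ ⟨hinj, hsurj⟩, hρ⟩

theorem cohomology_tensor_ext {M : Type w} [AddCommGroup M] [Module ℚ M]
    {f g : (A.tensor B).H →ₗ[ℚ] M}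
    (h : ∀ p q, ∀ z : LinearMap.ker A.d, z.1 ∈ A.gr p → ∀ w : LinearMap.ker B.d, w.1 ∈ B.gr q →
      f (Cohomology.cls _ (tensorCocycle z w)) = g (Cohomology.cls _ (tensorCocycle z w))) :
    f = g := by
  obtain ⟨κ, hκ⟩ := exists_kunnethEquiv A B
  have hκ_symm (z : LinearMap.ker A.d) (w : LinearMap.ker B.d) :
      κ.symm (Cohomology.cls A.d z ⊗ₜ Cohomology.cls B.d w) =
        Cohomology.cls _ (tensorCocycle z w) := by
    rw [← hκ, κ.symm_apply_apply]
  let F (φ : (A.tensor B).H →ₗ[ℚ] M) := (TensorProduct.mk ℚ A.H B.H).compr₂ (φ ∘ₗ κ.symm)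
  refine (LinearMap.cancel_right κ.symm.surjective).1 <|
    TensorProduct.ext <| LinearMap.ext₂ fun x y => ?_
  refine homogeneous_induction A.internalH (f := (F f).flip y) (g := (F g).flip y) ?_ x
  rintro p _ ⟨z, hz, rfl⟩
  refine homogeneous_induction B.internalH (f := F f (Cohomology.cls A.d z))
    (g := F g (Cohomology.cls A.d z)) ?_ y
  rintro q _ ⟨w, hw, rfl⟩
  simpa [F, hκ_symm] using h p q z hz w hw

theorem cls_tensorCocycle_mul {p q : ℤ} (z : LinearMap.ker A.d) {w : LinearMap.ker B.d}
    (hw : w.1 ∈ B.gr q) {z' : LinearMap.ker A.d} (hz' : z'.1 ∈ A.gr p) (w' : LinearMap.ker B.d) :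
    Cohomology.cls (A.tensor B).d (tensorCocycle z w) *
        Cohomology.cls (A.tensor B).d (tensorCocycle z' w') =
      (-1 : ℚ) ^ (q * p) •
        Cohomology.cls (A.tensor B).d (tensorCocycle (A.mulZ z z') (B.mulZ w w')) := by
  rw [cls_mul, ← map_smul]
  exact congrArg _ (Subtype.ext (tmk_mul_tmk A B z.1 hw hz' w'.1))

variable {m n : ℤ} {ε : Module.Dual ℚ A.H} {ε' : Module.Dual ℚ B.H}
  {E : Module.Dual ℚ (A.tensor B).H}

theorem mem_dualGr_cohomology_tensor (hε : ε ∈ dualGr A.grH m) (hε' : ε' ∈ dualGr B.grH n)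
    (hE : ∀ z w, E (Cohomology.cls _ (tensorCocycle z w)) =
      ε (Cohomology.cls A.d z) * ε' (Cohomology.cls B.d w)) :
    E ∈ dualGr (A.tensor B).grH (m + n) := by
  suffices E ∘ₗ proj (A.tensor B).internalH (m + n) = E from
    this ▸ comp_proj_mem_dualGr (A.tensor B).internalH (m + n) E
  refine cohomology_tensor_ext fun p q z hz w hw => ?_
  have hzw : Cohomology.cls _ (tensorCocycle z w) ∈ (A.tensor B).grH (p + q) :=
    ⟨_, tmk_mem A B hz hw, rfl⟩
  rcases eq_or_ne (p + q) (m + n) with hpq | hpq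
  · rw [LinearMap.comp_apply, proj_of_mem _ (hpq ▸ hzw)]
  · rw [LinearMap.comp_apply, proj_of_mem_ne _ hpq hzw, map_zero, hE]
    rcases eq_or_ne p m with rfl | hp
    · rw [mem_dualGr.1 hε' q (by lia) _ ⟨w, hw, rfl⟩, mul_zero]
    · rw [mem_dualGr.1 hε p hp _ ⟨z, hz, rfl⟩, zero_mul]

theorem apply_cls_tensorCocycle_mul (hε' : ε' ∈ dualGr B.grH n)
    (hE : ∀ z w, E (Cohomology.cls _ (tensorCocycle z w)) =
      ε (Cohomology.cls A.d z) * ε' (Cohomology.cls B.d w))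
    {p q r : ℤ} (z : LinearMap.ker A.d) {a : LinearMap.ker A.d} {w b : LinearMap.ker B.d}
    (ha : a.1 ∈ A.gr p) (hb : b.1 ∈ B.gr q) (hw : w.1 ∈ B.gr r) :
    E (Cohomology.cls (A.tensor B).d (tensorCocycle z w) *
        Cohomology.cls (A.tensor B).d (tensorCocycle a b)) =
      (-1 : ℚ) ^ ((n - q) * p) * (ε (Cohomology.cls A.d z * Cohomology.cls A.d a) *
        ε' (Cohomology.cls B.d w * Cohomology.cls B.d b)) := by
  rw [cls_tensorCocycle_mul z hw ha b, map_smul, hE, smul_eq_mul, cls_mul, cls_mul]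
  rcases eq_or_ne r (n - q) with rfl | hr
  · rfl
  · have hwb : Cohomology.cls B.d (B.mulZ w b) ∈ B.grH (r + q) :=
      ⟨_, SetLike.GradedMul.mul_mem hw hb, rfl⟩
    rw [mem_dualGr.1 hε' _ (show r + q ≠ n by lia) _ hwb, mul_zero, mul_zero, mul_zero]

theorem surjective_pairing_tensor (hε : A.cohomology.IsFrobeniusForm m ε)
    (hε' : B.cohomology.IsFrobeniusForm n ε')
    (hE : ∀ z w, E (Cohomology.cls _ (tensorCocycle z w)) =
      ε (Cohomology.cls A.d z) * ε' (Cohomology.cls B.d w)) :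
    Function.Surjective ((A.tensor B).cohomology.pairing E) := by
  have : FiniteDimensional ℚ A.H := hε.finiteDimensional
  have : FiniteDimensional ℚ B.H := hε'.finiteDimensional
  obtain ⟨κ, hκ⟩ := A.exists_kunnethEquiv B
  let α : A.H →ₗ[ℚ] Module.Dual ℚ A.H := A.cohomology.pairing ε
  let β : B.H →ₗ[ℚ] Module.Dual ℚ B.H := B.cohomology.pairing ε'
  let Φ : (A.tensor B).H →ₗ[ℚ] Module.Dual ℚ (A.tensor B).H :=
    κ.toLinearMap.dualMap ∘ₗ TensorProduct.dualDistrib ℚ A.H B.H ∘ₗ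
      TensorProduct.map α β ∘ₗ κ.toLinearMap
  have hΦ : Function.Surjective Φ :=
    κ.dualMap.surjective.comp <| (TensorProduct.dualDistribEquiv ℚ A.H B.H).surjective.comp <|
      (TensorProduct.map_surjective hε.surjective hε'.surjective).comp κ.surjective
  have hΦ_cls (z a : LinearMap.ker A.d) (w b : LinearMap.ker B.d) :
      Φ (Cohomology.cls _ (tensorCocycle a b)) (Cohomology.cls _ (tensorCocycle z w)) =
        ε (Cohomology.cls A.d z * Cohomology.cls A.d a) *
          ε' (Cohomology.cls B.d w * Cohomology.cls B.d b) := by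
    simp only [Φ, LinearMap.comp_apply, LinearEquiv.coe_coe, LinearMap.dualMap_apply, hκ,
      TensorProduct.map_tmul, TensorProduct.dualDistrib_apply]
    rfl
  have hrange : (LinearMap.range ((A.tensor B).cohomology.pairing E)).mkQ ∘ₗ Φ = 0 := by
    refine cohomology_tensor_ext fun p q a ha b hb => ?_
    refine (Submodule.Quotient.mk_eq_zero _).2 ⟨(-1 : ℚ) ^ ((n - q) * p) •
      Cohomology.cls _ (tensorCocycle a b), cohomology_tensor_ext fun _ r z _ w hw => ?_⟩
    change E (Cohomology.cls (A.tensor B).d (tensorCocycle z w) * ((-1 : ℚ) ^ ((n - q) * p) •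
      Cohomology.cls (A.tensor B).d (tensorCocycle a b))) = _
    rw [mul_smul_comm, map_smul, apply_cls_tensorCocycle_mul hε'.mem_dualGr hE z ha hb hw,
      smul_eq_mul, ← mul_assoc, sgn_mul_self, one_mul]
    exact (hΦ_cls z a w b).symm
  intro ψ
  obtain ⟨c, rfl⟩ := hΦ ψ
  exact (Submodule.Quotient.mk_eq_zero _).1 (LinearMap.congr_fun hrange c)

theorem exists_isFrobeniusForm_tensor (hε : A.cohomology.IsFrobeniusForm m ε)
    (hε' : B.cohomology.IsFrobeniusForm n ε') :
    ∃ E, (A.tensor B).cohomology.IsFrobeniusForm (m + n) E := by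
  have : FiniteDimensional ℚ A.H := hε.finiteDimensional
  have : FiniteDimensional ℚ B.H := hε'.finiteDimensional
  obtain ⟨κ, hκ⟩ := A.exists_kunnethEquiv B
  let E := κ.toLinearMap.dualMap (TensorProduct.dualDistrib ℚ A.H B.H (ε ⊗ₜ ε'))
  have hE (z : LinearMap.ker A.d) (w : LinearMap.ker B.d) :
      E (Cohomology.cls _ (tensorCocycle z w)) =
        ε (Cohomology.cls A.d z) * ε' (Cohomology.cls B.d w) := by
    simp [E, hκ]
  exact ⟨E, κ.symm.finiteDimensional, mem_dualGr_cohomology_tensor hε.mem_dualGr hε'.mem_dualGr hE,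
    surjective_pairing_tensor hε hε' hE⟩

end CDGA

end RHT

end

theorem mainTheorem4_general (A : RHT.CDGA.{u}) {m : ℤ} {ε : Module.Dual ℚ A.cohomology}
    (hε : A.cohomology.IsFrobeniusForm m ε) (n : ℕ) :
    Function.Injective (RHT.projTC A n).H ↔ (RHT.projTC A n).HasHomotopyRetraction := by
  obtain ⟨E, hE⟩ := RHT.CDGA.exists_isFrobeniusForm_tensor hε hε
  exact (RHT.DGModule.Hom.hasHomotopyRetraction_iff hE).symm

/-- Let `X` be a simply connected space of the homotopy type of a CW complex of finite type, with
Sullivan model `(ΛV, d)`. If `H^*(X)` is a Poincaré duality algebra, then `htc(X) = mtc(X)`. -/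
theorem mainTheorem4 (X : Type u) [TopologicalSpace X] [SimplyConnectedSpace X]
    (hX : RHT.HasFiniteTypeCWHomotopyType X) (S : RHT.SullivanModel.{u, v} X)
    (hPD : (RHT.rationalCohomology X).IsPoincareDualityAlgebra) :
    S.htc = S.mtc := by
  obtain ⟨m, ε, hε⟩ := hPD.exists_isFrobeniusForm
  simp only [RHT.SullivanModel.htc, RHT.SullivanModel.mtc,
    mainTheorem4_general _ (S.isQuasiIso.isFrobeniusForm hε)]
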